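/- Let $d,N$ be natural numbers with $N\ge 1$, let $1<p<\infty$, and let $\lambda_1,\dots,\lambda_N>0$ satisfy $\sum_{i=1}^N\lambda_i=1$. Let $\mu_1,\dots,\mu_N$ be Borel probability measures on $\mathbb{R}^d$ with finite $p$-th moments, $\int|x|^p\,d\mu_i<\infty$, where $|\cdot|$ is the Euclidean norm. Set $$c_p(x_1,\dots,x_N)=\min_{z\in\mathbb{R}^d}\sum_{i=1}^N\lambda_i|x_i-z|^p,\qquad C=\inf_{\gamma\in\Pi(\mu_1,\dots,\mu_N)}\int_{(\mathbb{R}^d)^N}c_p\,d\gamma,$$ where $\Pi(\mu_1,\dots,\mu_N)$ is the set of Borel probability measures on $(\mathbb{R}^d)^N$ with marginals $\mu_1,\dots,\mu_N$. Let $\mathcal{A}$ be the set of tuples $(\varphi_1,\dots,\varphi_N)$ of functions $\varphi_i:\mathbb{R}^d\to\mathbb{R}\cup\{-\infty\}$ with $\varphi_i\in L^1(\mu_i)$ (in particular $\varphi_i$ is finite $\mu_i$-a.e.) and $$\varphi_1(x_1)+\dots+\varphi_N(x_N)\le c_p(x_1,\dots,x_N)\quad\text{for all }x_1,\dots,x_N\in\mathbb{R}^d.$$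 For $\psi:\mathbb{R}^d\to\mathbb{R}$ and $\lambda>0$ let $\psi^{\lambda,p}(x)=\inf_{z\in\mathbb{R}^d}\{\lambda|x-z|^p-\psi(z)\}\in\mathbb{R}\cup\{-\infty\}$. Let $\mathcal{B}$ be the set of those $(\varphi_1,\dots,\varphi_N)\in\mathcal{A}$ for which there are continuous functions $\psi_1,\dots,\psi_N:\mathbb{R}^d\to\mathbb{R}$ such that $(1+|\cdot|^p)^{-1}\psi_i$ is bounded and $\varphi_i=\psi_i^{\lambda_i,p}$ for every $i$, and $\sum_{i=1}^N\psi_i=0$. Then the infimum $C$ is finite and attained, and $$C=\min_{\gamma\in\Pi(\mu_1,\dots,\mu_N)}\int c_p\,d\gamma=\sup_{(\varphi_1,\dots,\varphi_N)\in\mathcal{A}}\ \sum_{i=1}^N\int_{\mathbb{R}^d}\varphi_i\,d\mu_i .$$ Moreover, there is a maximizer $(\widetilde\varphi_1,\dots,\widetilde\varphi_N)$ of the supremum over $\mathcal{A}$ which belongs to $\mathcal{B}$ and is such that, for every $i$, for Lebesgue-almost every point $x$ of the convex hull of $\operatorname{supp}\mu_i$, the function $\widetilde\varphi_i$ is finite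 near $x$ and differentiable at $x$. -/

import Mathlib

open MeasureTheory Topology
open scoped ENNReal

noncomputable section

namespace MMOT

/-- The Euclidean space `ℝ^d`. -/
abbrev Space (d : ℕ) : Type := EuclideanSpace ℝ (Fin d)

variable {d N : ℕ}

/-- The cost `c_p(x₁, …, x_N) = min_z ∑ i, λ_i |x_i - z|^p`. For positive weights and `p > 0` the
function of `z` is continuous, nonnegative and coercive, so the infimum is attained. -/
def cost (p : ℝ) (lam : Fin N → ℝ) (x : Fin N → Space d) : ℝ :=
  ⨅ z : Space d, ∑ i, lam i * ‖x i - z‖ ^ p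

/-- The probability measures on `(ℝ^d)^N` with marginals `μ 0, …, μ (N - 1)`. -/
def plans (μ : Fin N → Measure (Space d)) : Set (Measure (Fin N → Space d)) :=
  {γ | IsProbabilityMeasure γ ∧ ∀ i, γ.map (fun x => x i) = μ i}

/-- The transport cost `∫ c_p dγ`, as a number in `[0, ∞]`. -/
def transportCost (p : ℝ) (lam : Fin N → ℝ) (γ : Measure (Fin N → Space d)) : ℝ≥0∞ :=
  ∫⁻ x, ENNReal.ofReal (cost p lam x) ∂γ

/-- The value of the multi-marginal optimal transport problem with cost `c_p`. -/
def primalValue (p : ℝ) (lam : Fin N → ℝ) (μ : Fin N → Measure (Space d)) : ℝ≥0∞ :=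
  ⨅ γ ∈ plans μ, transportCost p lam γ

/-- `φ ∈ L¹(μ)` for an extended-real function `φ`: it is `μ`-a.e. finite and (its real part)
integrable. -/
def IsL1 (μ : Measure (Space d)) (φ : Space d → EReal) : Prop :=
  (∀ᵐ x ∂μ, φ x ≠ ⊥ ∧ φ x ≠ ⊤) ∧ Integrable (fun x => (φ x).toReal) μ

/-- The class `A(c_p)` of the competitors of the dual problem: tuples of `L¹(μ_i)` functions with
values in `ℝ ∪ {-∞}` such that `φ₁(x₁) + ⋯ + φ_N(x_N) ≤ c_p(x₁, …, x_N)` for all `x`. -/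
def dualClass (p : ℝ) (lam : Fin N → ℝ) (μ : Fin N → Measure (Space d)) :
    Set (Fin N → Space d → EReal) :=
  {φ | (∀ i, IsL1 (μ i) (φ i)) ∧ (∀ i x, φ i x ≠ ⊤) ∧
    ∀ x : Fin N → Space d, ∑ i, φ i (x i) ≤ (cost p lam x : EReal)}

/-- The dual functional `∑ i, ∫ φ_i dμ_i`. -/
def dualValue (μ : Fin N → Measure (Space d)) (φ : Fin N → Space d → EReal) : ℝ :=
  ∑ i, ∫ x, (φ i x).toReal ∂μ i

/-- Continuous functions of at most `p`-growth. -/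
def growthSpace (p : ℝ) : Set (Space d → ℝ) :=
  {ψ | Continuous ψ ∧ ∃ C : ℝ, ∀ x, |ψ x| ≤ C * (1 + ‖x‖ ^ p)}

/-- The conjugate `ψ^{l,p}(x) = inf_z (l |x - z|^p - ψ(z))`, with values in `ℝ ∪ {-∞}`. -/
def conjugate (l p : ℝ) (ψ : Space d → ℝ) (x : Space d) : EReal :=
  ⨅ z : Space d, ((l * ‖x - z‖ ^ p - ψ z : ℝ) : EReal)

/-- The class `B(c_p)`: the elements of `A(c_p)` of the form `φ_i = ψ_i^{λ_i,p}` with `ψ_i`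
continuous of at most `p`-growth and `∑ i, ψ_i = 0`. -/
def conjugateClass (p : ℝ) (lam : Fin N → ℝ) (μ : Fin N → Measure (Space d)) :
    Set (Fin N → Space d → EReal) :=
  {φ | φ ∈ dualClass p lam μ ∧ ∃ ψ : Fin N → Space d → ℝ,
    (∀ i, ψ i ∈ growthSpace p) ∧ (∀ z, ∑ i, ψ i z = 0) ∧
    ∀ i, φ i = conjugate (lam i) p (ψ i)}

/-- An extended-real function is differentiable at `x` if near `x` it is finite and coincides with
a real function which is differentiable at `x`. -/
def EDifferentiableAt (φ : Space d → EReal) (x : Space d) : Prop :=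
  ∃ g : Space d → ℝ, (∀ᶠ y in 𝓝 x, φ y = (g y : EReal)) ∧ DifferentiableAt ℝ g x

end MMOT

end

namespace MMOT

/-! ### The barycenter cost -/

section Cost

variable {d N : ℕ} {p : ℝ} {lam : Fin N → ℝ}

/-! The strategy is to read the potentials off an optimal plan. Plans form a compact set and the
cost is continuous and nonnegative, so an optimal plan `γ` exists (`exists_optimal_plan`).
Recombining coordinates of finitely many points of its support `Γ` cannot lower the cost: otherwise
small pieces of `γ` near these points could be exchanged for products of their marginals
(`sum_cost_le_of_mem_support`). By linear programming duality on finite subsets of `Γ` and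
Tychonoff's theorem, there are `u i` on `Γ` whose sum is at most the cost of every recombination,
with equality on `Γ` (`exists_splitting`).

Infimal convolution turns the `u i` into continuous `ψ i` of `p`-growth; since the cost is itself an
infimum over `z`, their sum can be made zero while the conjugate of `ψ i` still dominates `u i`
(`exists_potentials`). The conjugates always sum to at most the cost, hence to exactly the cost on
`Γ`, and integrating against `γ` gives equality in weak duality (`conjugate_mem_dualClass`,
`dualValue_le`).

A conjugate that is finite `μ i`-a.e. is bounded below near each interior point of the convex hull
of the support, hence Lipschitz there. Rademacher's theorem and the nullity of the boundary of a
convex set give differentiability (`ae_eDifferentiableAt_conjugate`). -/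

lemma sum_cost_nonneg (hlam : ∀ i, 0 < lam i) (x : Fin N → Space d) (z : Space d) :
    0 ≤ ∑ i, lam i * ‖x i - z‖ ^ p :=
  Finset.sum_nonneg fun i _ => mul_nonneg (hlam i).le (Real.rpow_nonneg (norm_nonneg _) _)

lemma bddBelow_range_sum_cost (hlam : ∀ i, 0 < lam i) (x : Fin N → Space d) :
    BddBelow (Set.range fun z : Space d => ∑ i, lam i * ‖x i - z‖ ^ p) :=
  ⟨0, by rintro _ ⟨z, rfl⟩; exact sum_cost_nonneg hlam x z⟩

lemma cost_nonneg (hlam : ∀ i, 0 < lam i) (x : Fin N → Space d) : 0 ≤ cost p lam x :=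
  le_ciInf fun z => sum_cost_nonneg hlam x z

lemma cost_le (hlam : ∀ i, 0 < lam i) (x : Fin N → Space d) (z : Space d) :
    cost p lam x ≤ ∑ i, lam i * ‖x i - z‖ ^ p :=
  ciInf_le (bddBelow_range_sum_cost hlam x) z

/-- After scaling the `i`-th coordinate by `lam i ^ (1 / p)`, the cost is the `p`-th power of the
`ℓ^p` distance to the image of the diagonal, and a distance to a set is continuous. -/
lemma continuous_cost (hp : 1 < p) (hlam : ∀ i, 0 < lam i) :
    Continuous (cost p lam : (Fin N → Space d) → ℝ) := by
  have hp0 : 0 < p := by linarith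
  have hfact : Fact (1 ≤ ENNReal.ofReal p) := ⟨by simpa using hp.le⟩
  let T : (Fin N → Space d) → PiLp (ENNReal.ofReal p) (fun _ : Fin N => Space d) :=
    fun x => WithLp.toLp _ (fun i => (lam i ^ (1 / p)) • x i)
  have hT : Continuous T := by
    refine (PiLp.continuous_toLp _ _).comp ?_
    fun_prop
  let D : Set (PiLp (ENNReal.ofReal p) (fun _ : Fin N => Space d)) :=
    Set.range fun z : Space d => T fun _ => z
  have htr : (ENNReal.ofReal p).toReal = p := ENNReal.toReal_ofReal hp0.le
  have hdist (x : Fin N → Space d) (z : Space d) :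
      dist (T x) (T fun _ => z) ^ p = ∑ i, lam i * ‖x i - z‖ ^ p := by
    rw [PiLp.dist_eq_sum (by rw [htr]; exact hp0), htr, ← Real.rpow_mul
      (Finset.sum_nonneg fun i _ => Real.rpow_nonneg dist_nonneg _),
      one_div_mul_cancel hp0.ne', Real.rpow_one]
    refine Finset.sum_congr rfl fun i _ => ?_
    simp only [T]
    rw [dist_eq_norm, ← smul_sub, norm_smul, Real.norm_of_nonneg (Real.rpow_nonneg (hlam i).le _),
      Real.mul_rpow (Real.rpow_nonneg (hlam i).le _) (norm_nonneg _), ← Real.rpow_mul (hlam i).le,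
      one_div_mul_cancel hp0.ne', Real.rpow_one]
  have key (x : Fin N → Space d) : cost p lam x = Metric.infDist (T x) D ^ p := by
    apply le_antisymm
    · have h : cost p lam x ^ (1 / p) ≤ Metric.infDist (T x) D := by
        refine (Metric.le_infDist (Set.range_nonempty _)).2 ?_
        rintro _ ⟨z, rfl⟩
        have h1 := cost_le (p := p) hlam x z
        rw [← hdist] at h1
        calc cost p lam x ^ (1 / p) ≤ (dist (T x) (T fun _ => z) ^ p) ^ (1 / p) :=
              Real.rpow_le_rpow (cost_nonneg hlam x) h1 (by positivity)
          _ = _ := by rw [← Real.rpow_mul dist_nonneg, mul_one_div_cancel hp0.ne', Real.rpow_one]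
      calc cost p lam x = (cost p lam x ^ (1 / p)) ^ p := by
            rw [← Real.rpow_mul (cost_nonneg hlam x), one_div_mul_cancel hp0.ne', Real.rpow_one]
        _ ≤ _ := Real.rpow_le_rpow (Real.rpow_nonneg (cost_nonneg hlam x) _) h hp0.le
    · refine le_ciInf fun z => ?_
      rw [← hdist]
      exact Real.rpow_le_rpow Metric.infDist_nonneg
        (Metric.infDist_le_dist_of_mem ⟨z, rfl⟩) hp0.le
  rw [show (cost p lam : (Fin N → Space d) → ℝ) = fun x => Metric.infDist (T x) D ^ p from
    funext key]
  exact ((Metric.continuous_infDist_pt D).comp hT).rpow_const fun _ => Or.inr hp0.le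

end Cost

/-! ### Transport plans -/

section Plans

variable {d N : ℕ}

/-- The function `∫ f dγ` of a probability measure `γ` is lower semicontinuous if `f ≥ 0` is
continuous. -/
lemma lowerSemicontinuous_lintegral_ofReal {X : Type*} [TopologicalSpace X] [MeasurableSpace X]
    [BorelSpace X] {f : X → ℝ} (hf : Continuous f) :
    LowerSemicontinuous fun γ : ProbabilityMeasure X => ∫⁻ x, ENNReal.ofReal (f x) ∂(γ : Measure X) := by
  -- Truncation at height `n` gives bounded continuous functions, whose integrals are weakly
  -- continuous and increase to the integral of `f`.
  let g (n : ℕ) : BoundedContinuousFunction X NNReal :=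
    BoundedContinuousFunction.mkOfBound ⟨fun x => min (f x).toNNReal n, by fun_prop⟩ n (by
      intro x y
      rw [NNReal.dist_eq, abs_le]
      have h1 : ((min (f x).toNNReal n : NNReal) : ℝ) ≤ n := by
        exact_mod_cast min_le_right _ _
      have h2 : ((min (f y).toNNReal n : NNReal) : ℝ) ≤ n := by
        exact_mod_cast min_le_right _ _
      have h3 := (min (f x).toNNReal n : NNReal).coe_nonneg
      have h4 := (min (f y).toNNReal n : NNReal).coe_nonneg
      constructor <;> simp only [ContinuousMap.coe_mk] <;> linarith)
  have hg (γ : ProbabilityMeasure X) :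
      ∫⁻ x, ENNReal.ofReal (f x) ∂(γ : Measure X) = ⨆ n, ∫⁻ x, g n x ∂(γ : Measure X) := by
    rw [← lintegral_iSup]
    · refine lintegral_congr fun x => le_antisymm ?_ ?_
      · obtain ⟨n, hn⟩ := exists_nat_ge (f x).toNNReal
        refine le_iSup_of_le n ?_
        simp only [g, ENNReal.ofReal]
        exact ENNReal.coe_le_coe.2 (le_min le_rfl hn)
      · exact iSup_le fun n => ENNReal.coe_le_coe.2 (min_le_left _ _)
    · exact fun n => (g n).continuous.measurable.coe_nnreal_ennreal
    · intro m n hmn x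
      refine ENNReal.coe_le_coe.2 (min_le_min_left _ (by exact_mod_cast hmn))
  simp_rw [hg]
  refine lowerSemicontinuous_iSup fun n => Continuous.lowerSemicontinuous ?_
  refine continuous_iff_continuousAt.2 fun γ => ?_
  exact ProbabilityMeasure.tendsto_iff_forall_lintegral_tendsto.1 Filter.tendsto_id (g n)

variable {μ : Fin N → Measure (Space d)}

lemma pi_mem_plans (hprob : ∀ i, IsProbabilityMeasure (μ i)) : Measure.pi μ ∈ plans μ :=
  ⟨inferInstance, fun i => (measurePreserving_eval μ i).map_eq⟩

/-- Prokhorov's theorem: the marginal constraints are weakly closed, and tightness of each `μ i`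
gives tightness of the plans through products of compact sets. -/
lemma isCompact_plans (hprob : ∀ i, IsProbabilityMeasure (μ i)) :
    IsCompact {γ : ProbabilityMeasure (Fin N → Space d) | (γ : Measure _) ∈ plans μ} := by
  set S : Set (ProbabilityMeasure (Fin N → Space d)) := {γ | (γ : Measure _) ∈ plans μ} with hS
  have hclosed : IsClosed S := by
    have : S = ⋂ i, {γ : ProbabilityMeasure (Fin N → Space d) |
        γ.map (continuous_apply i).measurable.aemeasurable =
          (⟨μ i, hprob i⟩ : ProbabilityMeasure (Space d))} := by
      ext γ
      simp only [hS, plans, Set.mem_ofPred_eq, Set.mem_iInter]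
      refine ⟨fun h i => ?_, fun h => ⟨inferInstance, fun i => ?_⟩⟩
      · apply Subtype.ext
        exact h.2 i
      · exact congrArg Subtype.val (h i)
    rw [this]
    exact isClosed_iInter fun i =>
      isClosed_eq (ProbabilityMeasure.continuous_map (continuous_apply i)) continuous_const
  rw [← hclosed.closure_eq]
  refine isCompact_closure_of_isTightMeasureSet ?_
  rw [isTightMeasureSet_iff_exists_isCompact_measure_compl_le]
  intro ε hε
  -- The denominator `N + 1` stays nonzero when `N = 0`.
  have hδ : 0 < ε / (N + 1 : ℕ) := ENNReal.div_pos hε.ne' (by simp)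
  have hK (i : Fin N) : ∃ K : Set (Space d), IsCompact K ∧ μ i Kᶜ ≤ ε / (N + 1 : ℕ) := by
    have := hprob i
    obtain ⟨K, hK, h⟩ := isTightMeasureSet_iff_exists_isCompact_measure_compl_le.1
      (isTightMeasureSet_singleton (μ := μ i)) _ hδ
    exact ⟨K, hK, h _ rfl⟩
  choose K hK hμK using hK
  refine ⟨Set.univ.pi K, isCompact_univ_pi hK, ?_⟩
  rintro _ ⟨γ, hγ, rfl⟩
  have hsub : (Set.univ.pi K)ᶜ ⊆ ⋃ i, (fun x : Fin N → Space d => x i) ⁻¹' (K i)ᶜ := by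
    intro x hx
    simpa [Set.mem_pi] using hx
  calc (γ : Measure _) (Set.univ.pi K)ᶜ
      ≤ ∑ i, (γ : Measure _) ((fun x : Fin N → Space d => x i) ⁻¹' (K i)ᶜ) :=
        (measure_mono hsub).trans (measure_iUnion_fintype_le _ _)
    _ = ∑ i, μ i (K i)ᶜ := by
        refine Finset.sum_congr rfl fun i _ => ?_
        rw [← hγ.2 i, Measure.map_apply (measurable_pi_apply i) (hK i).measurableSet.compl]
    _ ≤ ∑ _i : Fin N, ε / (N + 1 : ℕ) := Finset.sum_le_sum fun i _ => hμK i
    _ = N * (ε / (N + 1 : ℕ)) := by simp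
    _ ≤ (N + 1 : ℕ) * (ε / (N + 1 : ℕ)) := by gcongr; simp
    _ ≤ ε := ENNReal.mul_div_le

variable {p : ℝ} {lam : Fin N → ℝ}

lemma exists_optimal_plan (hp : 1 < p) (hlam : ∀ i, 0 < lam i)
    (hprob : ∀ i, IsProbabilityMeasure (μ i)) :
    ∃ γ ∈ plans μ, transportCost p lam γ = primalValue p lam μ := by
  set S : Set (ProbabilityMeasure (Fin N → Space d)) := {γ | (γ : Measure _) ∈ plans μ} with hS
  have hne : S.Nonempty := ⟨⟨Measure.pi μ, inferInstance⟩, Set.mem_ofPred_eq ▸ pi_mem_plans hprob⟩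
  obtain ⟨γ, hγ, hmin⟩ := ((lowerSemicontinuous_lintegral_ofReal
    (continuous_cost (d := d) hp hlam)).lowerSemicontinuousOn _).exists_isMinOn hne
    (isCompact_plans hprob)
  have hγ' : (γ : Measure _) ∈ plans μ := hγ
  refine ⟨γ, hγ', le_antisymm (le_iInf₂ fun γ' hγ' => ?_) (iInf₂_le (f := fun γ (_ : γ ∈ plans μ) => transportCost p lam γ) _ hγ')⟩
  have hmem : (⟨γ', hγ'.1⟩ : ProbabilityMeasure _) ∈ S := Set.mem_ofPred_eq ▸ hγ'
  exact hmin hmem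

lemma integrable_comp_eval {γ : Measure (Fin N → Space d)} (hγ : γ ∈ plans μ) (i : Fin N)
    {f : Space d → ℝ} (hf : Integrable f (μ i)) : Integrable (fun x => f (x i)) γ := by
  rw [← hγ.2 i] at hf
  exact hf.comp_measurable (measurable_pi_apply i)

lemma integral_comp_eval {γ : Measure (Fin N → Space d)} (hγ : γ ∈ plans μ) (i : Fin N)
    {f : Space d → ℝ} (hf : AEStronglyMeasurable f (μ i)) :
    ∫ x, f (x i) ∂γ = ∫ x, f x ∂μ i := by
  rw [← hγ.2 i] at hf ⊢
  exact (integral_map (measurable_pi_apply i).aemeasurable hf).symm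

lemma integrable_cost (hp : 1 < p) (hlam : ∀ i, 0 < lam i)
    (hmom : ∀ i, Integrable (fun x => ‖x‖ ^ p) (μ i)) {γ : Measure (Fin N → Space d)}
    (hγ : γ ∈ plans μ) : Integrable (cost p lam) γ := by
  refine Integrable.mono' (g := fun x => ∑ i, lam i * ‖x i‖ ^ p) ?_
    (continuous_cost hp hlam).aestronglyMeasurable (Filter.Eventually.of_forall fun x => ?_)
  · exact integrable_finsetSum _ fun i _ => (integrable_comp_eval hγ i (hmom i)).const_mul _
  · rw [Real.norm_of_nonneg (cost_nonneg hlam x)]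
    simpa using cost_le (p := p) hlam x 0

lemma transportCost_eq (hp : 1 < p) (hlam : ∀ i, 0 < lam i)
    (hmom : ∀ i, Integrable (fun x => ‖x‖ ^ p) (μ i)) {γ : Measure (Fin N → Space d)}
    (hγ : γ ∈ plans μ) : transportCost p lam γ = ENNReal.ofReal (∫ x, cost p lam x ∂γ) :=
  (ofReal_integral_eq_lintegral_ofReal (integrable_cost hp hlam hmom hγ)
    (Filter.Eventually.of_forall (cost_nonneg hlam))).symm

end Plans

end MMOT

namespace MMOT

/-! ### Finite optimality on the support of an optimal plan -/

section Support

variable {d N : ℕ} {p : ℝ} {lam : Fin N → ℝ} {μ : Fin N → Measure (Space d)}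

lemma integral_le_of_optimal (hp : 1 < p) (hlam : ∀ i, 0 < lam i)
    (hmom : ∀ i, Integrable (fun x => ‖x‖ ^ p) (μ i)) {γ γ' : Measure (Fin N → Space d)}
    (hγ : γ ∈ plans μ) (hopt : transportCost p lam γ = primalValue p lam μ) (hγ' : γ' ∈ plans μ) :
    ∫ x, cost p lam x ∂γ ≤ ∫ x, cost p lam x ∂γ' := by
  have h : transportCost p lam γ ≤ transportCost p lam γ' := by
    rw [hopt]
    exact iInf₂_le (f := fun γ (_ : γ ∈ plans μ) => transportCost p lam γ) _ hγ'
  rw [transportCost_eq hp hlam hmom hγ, transportCost_eq hp hlam hmom hγ'] at h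
  exact (ENNReal.ofReal_le_ofReal_iff (integral_nonneg (cost_nonneg hlam))).1 h

lemma integrable_and_integral_near {X : Type*} [MeasurableSpace X] {ν : Measure X}
    [IsProbabilityMeasure ν] {f : X → ℝ} (hf : AEStronglyMeasurable f ν) {c η : ℝ}
    (h : ∀ᵐ x ∂ν, |f x - c| < η) : Integrable f ν ∧ |∫ x, f x ∂ν - c| ≤ η := by
  have hint : Integrable (fun x => f x - c) ν :=
    Integrable.mono' (integrable_const η) (hf.sub aestronglyMeasurable_const)
      (h.mono fun x hx => hx.le)
  have hf' : Integrable f ν := by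
    refine (hint.add (integrable_const c)).congr (Filter.Eventually.of_forall fun x => ?_)
    simp
  refine ⟨hf', ?_⟩
  have h1 : ∫ x, f x ∂ν - c = ∫ x, (f x - c) ∂ν := by
    rw [integral_sub hf' (integrable_const c)]; simp
  rw [h1]
  have h2 : ∀ᵐ x ∂ν, ‖f x - c‖ ≤ η := h.mono fun x hx => hx.le
  simpa using norm_integral_le_of_norm_le_const h2

lemma exists_uniform_radius {K : Type*} [Finite K] {f : (Fin N → Space d) → ℝ} (hf : Continuous f)
    (y : K → Fin N → Space d) {η : ℝ} (hη : 0 < η) :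
    ∃ δ > 0, ∀ (m : Fin N → K) (x : Fin N → Space d),
      (∀ i, dist (x i) (y (m i) i) < δ) → |f x - f fun i => y (m i) i| < η := by
  have h (m : Fin N → K) : ∀ᶠ δ in 𝓝[>] (0 : ℝ), ∀ x : Fin N → Space d,
      (∀ i, dist (x i) (y (m i) i) < δ) → |f x - f fun i => y (m i) i| < η := by
    obtain ⟨r, hr, h⟩ := Metric.continuousAt_iff.1
      (hf.continuousAt (x := fun i => y (m i) i)) η hη
    filter_upwards [Ioo_mem_nhdsGT hr] with δ hδ x hx
    exact h ((dist_pi_lt_iff hr).2 fun i => (hx i).trans hδ.2)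
  obtain ⟨δ, h1, h2⟩ := ((Filter.eventually_all.2 h).and self_mem_nhdsWithin).exists
  exact ⟨δ, h2, h1⟩

lemma isProbabilityMeasure_of_map_eval {γ : Measure (Fin N → Space d)} (i : Fin N)
    (hprob : IsProbabilityMeasure (μ i)) (h : γ.map (fun x => x i) = μ i) :
    IsProbabilityMeasure γ := by
  constructor
  have := congrArg (fun ν => ν Set.univ) h
  simpa [Measure.map_apply (measurable_pi_apply i)] using this

/-- Each conditional measure is at most `(γ (B k))⁻¹ • γ`, so a small multiple of any nonnegative
combination of them can be cut out of `γ` leaving a positive measure. -/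
lemma exists_pos_smul_cond_le {X K : Type*} [MeasurableSpace X] [Fintype K] {γ : Measure X}
    [IsFiniteMeasure γ] {B : K → Set X} (hB : ∀ k, γ (B k) ≠ 0) {a : K → ℝ} (ha : ∀ k, 0 ≤ a k) :
    ∃ ε > 0, ∑ k, ENNReal.ofReal (ε * a k) • ProbabilityTheory.cond γ (B k) ≤ γ := by
  set T : ℝ := ∑ k, a k * (γ.real (B k))⁻¹ with hT
  have hT0 : 0 ≤ T := Finset.sum_nonneg fun k _ =>
    mul_nonneg (ha k) (inv_nonneg.2 measureReal_nonneg)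
  refine ⟨(T + 1)⁻¹, by positivity, ?_⟩
  refine Measure.le_iff.2 fun s _ => ?_
  have h1 (k : K) : (γ (B k))⁻¹ = ENNReal.ofReal (γ.real (B k))⁻¹ := by
    have hk : 0 < γ.real (B k) := ENNReal.toReal_pos (hB k) (measure_ne_top _ _)
    rw [ENNReal.ofReal_inv_of_pos hk, ofReal_measureReal]
  rw [Measure.finsetSum_apply]
  calc ∑ k, (ENNReal.ofReal ((T + 1)⁻¹ * a k) • ProbabilityTheory.cond γ (B k)) s
      ≤ ∑ k, ENNReal.ofReal ((T + 1)⁻¹ * a k) * ENNReal.ofReal (γ.real (B k))⁻¹ * γ s := by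
        refine Finset.sum_le_sum fun k _ => ?_
        simp only [ProbabilityTheory.cond, Measure.smul_apply, smul_eq_mul, h1, mul_assoc]
        gcongr
        exact Measure.restrict_le_self
    _ = ENNReal.ofReal ((T + 1)⁻¹ * T) * γ s := by
        rw [← Finset.sum_mul]
        congr 1
        rw [hT, Finset.mul_sum, ENNReal.ofReal_sum_of_nonneg]
        · refine Finset.sum_congr rfl fun k _ => ?_
          rw [← ENNReal.ofReal_mul (mul_nonneg (by positivity) (ha k)), mul_assoc]
        · intro k _
          exact mul_nonneg (by positivity) (mul_nonneg (ha k) (inv_nonneg.2 measureReal_nonneg))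
    _ ≤ 1 * γ s := by
        gcongr
        rw [← ENNReal.ofReal_one]
        refine ENNReal.ofReal_le_ofReal ?_
        rw [inv_mul_le_iff₀ (by positivity)]
        linarith
    _ = γ s := one_mul _

/-- Rearranging finitely many points of the support of an optimal plan does not lower the cost. -/
lemma sum_cost_le_of_mem_support (hp : 1 < p) (hlam : ∀ i, 0 < lam i) (i₀ : Fin N)
    (hprob : ∀ i, IsProbabilityMeasure (μ i))
    (hmom : ∀ i, Integrable (fun x => ‖x‖ ^ p) (μ i)) {γ : Measure (Fin N → Space d)}
    (hγ : γ ∈ plans μ) (hopt : transportCost p lam γ = primalValue p lam μ)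
    {K : Type*} [Fintype K] (y : K → Fin N → Space d) (hy : ∀ k, y k ∈ γ.support)
    {a : K → ℝ} {b : (Fin N → K) → ℝ} (ha : ∀ k, 0 ≤ a k) (hb : ∀ m, 0 ≤ b m)
    (hab : ∀ (i : Fin N) (f : K → ℝ), ∑ m, b m * f (m i) = ∑ k, a k * f k) :
    ∑ k, a k * cost p lam (y k) ≤ ∑ m, b m * cost p lam (fun i => y (m i) i) := by
  by_contra! hlt
  have hγp : IsProbabilityMeasure γ := hγ.1
  set Δ := ∑ k, a k * cost p lam (y k) - ∑ m, b m * cost p lam (fun i => y (m i) i) with hΔ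
  have hΔ0 : 0 < Δ := by linarith
  set S := ∑ k, a k + ∑ m, b m with hS
  have hS0 : 0 ≤ S := add_nonneg (Finset.sum_nonneg fun k _ => ha k)
    (Finset.sum_nonneg fun m _ => hb m)
  -- The total mass involved is `S` (before scaling by `ε`), so an oscillation `η` of the cost near
  -- each point loses at most `η * S < Δ`.
  set η := Δ / (2 * (S + 1)) with hη
  have hη0 : 0 < η := by positivity
  have hηS : η * S < Δ := by
    rw [hη, div_mul_eq_mul_div, div_lt_iff₀ (by positivity)]
    nlinarith
  have hcont : Continuous (cost p lam : (Fin N → Space d) → ℝ) := continuous_cost hp hlam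
  obtain ⟨δ, hδ, hclose⟩ := exists_uniform_radius hcont y hη0
  set B : K → Set (Fin N → Space d) := fun k => Metric.ball (y k) δ with hB
  have hBm (k : K) : MeasurableSet (B k) := measurableSet_ball
  have hB0 (k : K) : γ (B k) ≠ 0 :=
    ((Measure.mem_support_iff_forall _).1 (hy k) _ (Metric.ball_mem_nhds _ hδ)).ne'
  obtain ⟨ε, hε, hle⟩ := exists_pos_smul_cond_le hB0 ha
  set ν : K → Measure (Fin N → Space d) := fun k => ProbabilityTheory.cond γ (B k) with hν
  have hνp (k : K) : IsProbabilityMeasure (ν k) := ProbabilityTheory.cond_isProbabilityMeasure (hB0 k)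
  have hνB (k : K) : ∀ᵐ x ∂ν k, x ∈ B k := ProbabilityTheory.ae_cond_mem (hBm k)
  set ρ : Fin N → K → Measure (Space d) := fun i k => (ν k).map (fun x => x i) with hρ
  have hρp (i : Fin N) (k : K) : IsProbabilityMeasure (ρ i k) :=
    Measure.isProbabilityMeasure_map (measurable_pi_apply i).aemeasurable
  have hρB (i : Fin N) (k : K) : ∀ᵐ x ∂ρ i k, dist x (y k i) < δ := by
    have hms : MeasurableSet {x : Space d | dist x (y k i) < δ} := measurableSet_ball
    refine (ae_map_iff (measurable_pi_apply i).aemeasurable hms).2 ?_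
    filter_upwards [hνB k] with x hx
    exact (dist_le_pi_dist x (y k) i).trans_lt hx
  -- The product of the localized marginals selected by `m` lives near the recombined point with
  -- coordinates `y (m i) i`.
  set β : (Fin N → K) → Measure (Fin N → Space d) := fun m => Measure.pi fun i => ρ i (m i) with hβ
  have hβB (m : Fin N → K) : ∀ᵐ x ∂β m, ∀ i, dist (x i) (y (m i) i) < δ := by
    refine ae_all_iff.2 fun i => ?_
    exact (measurePreserving_eval (fun i => ρ i (m i)) i).quasiMeasurePreserving.ae (hρB i (m i))
  set α : Measure (Fin N → Space d) := ∑ k, ENNReal.ofReal (ε * a k) • ν k with hα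
  have hαf : IsFiniteMeasure α := isFiniteMeasure_of_le γ hle
  -- The competitor is `γ - α + τ`: the pieces `α` are removed and their recombination `τ` is put
  -- back. The balance condition `hab`, tested on `k ↦ ρ i k s`, says that both have the same
  -- marginals.
  set γ₁ : Measure (Fin N → Space d) := γ - α with hγ₁
  set τ : Measure (Fin N → Space d) := ∑ m, ENNReal.ofReal (ε * b m) • β m with hτ
  have hsplit : γ₁ + α = γ := Measure.sub_add_cancel_of_le hle
  have hmapα (i : Fin N) : τ.map (fun x => x i) = α.map (fun x => x i) := by
    have hm : Measurable fun x : Fin N → Space d => x i := measurable_pi_apply i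
    ext s hs
    rw [Measure.map_apply hm hs, Measure.map_apply hm hs, hτ, hα, Measure.finsetSum_apply,
      Measure.finsetSum_apply]
    have e1 (m : Fin N → K) : (ENNReal.ofReal (ε * b m) • β m) ((fun x => x i) ⁻¹' s) =
        ENNReal.ofReal (ε * (b m * (ρ i (m i)).real s)) := by
      rw [Measure.smul_apply, smul_eq_mul, ← Measure.map_apply hm hs,
        (measurePreserving_eval (fun i => ρ i (m i)) i).map_eq, ← mul_assoc,
        ENNReal.ofReal_mul (mul_nonneg hε.le (hb m)), ofReal_measureReal]
    have e2 (k : K) : (ENNReal.ofReal (ε * a k) • ν k) ((fun x => x i) ⁻¹' s) =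
        ENNReal.ofReal (ε * (a k * (ρ i k).real s)) := by
      rw [Measure.smul_apply, smul_eq_mul, ← Measure.map_apply hm hs, ← mul_assoc,
        ENNReal.ofReal_mul (mul_nonneg hε.le (ha k)), ofReal_measureReal]
    simp_rw [e1, e2]
    rw [← ENNReal.ofReal_sum_of_nonneg, ← ENNReal.ofReal_sum_of_nonneg, ← Finset.mul_sum,
      ← Finset.mul_sum, hab i fun k => (ρ i k).real s]
    · exact fun k _ => mul_nonneg hε.le (mul_nonneg (ha k) measureReal_nonneg)
    · exact fun m _ => mul_nonneg hε.le (mul_nonneg (hb m) measureReal_nonneg)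
  have hmap (i : Fin N) : (γ₁ + τ).map (fun x => x i) = μ i := by
    have hm : Measurable fun x : Fin N → Space d => x i := measurable_pi_apply i
    rw [Measure.map_add _ _ hm, hmapα, ← Measure.map_add _ _ hm, hsplit, hγ.2 i]
  have hγ' : γ₁ + τ ∈ plans μ :=
    ⟨isProbabilityMeasure_of_map_eval i₀ (hprob i₀) (hmap i₀), hmap⟩
  have hineq := integral_le_of_optimal hp hlam hmom hγ hopt hγ'
  have hi := integrable_cost hp hlam hmom hγ
  have hi' := integrable_cost hp hlam hmom hγ'
  rw [← hsplit] at hineq hi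
  rw [integral_add_measure hi.left_of_add_measure hi.right_of_add_measure,
    integral_add_measure hi'.left_of_add_measure hi'.right_of_add_measure] at hineq
  have hνc (k : K) := integrable_and_integral_near (ν := ν k) (f := cost p lam)
    (c := cost p lam (y k)) (η := η) hcont.aestronglyMeasurable (by
      filter_upwards [hνB k] with x hx
      exact hclose (fun _ => k) x fun i => (dist_le_pi_dist x (y k) i).trans_lt hx)
  have hβc (m : Fin N → K) := integrable_and_integral_near (ν := β m) (f := cost p lam)
    (c := cost p lam fun i => y (m i) i) (η := η) hcont.aestronglyMeasurable (by
      filter_upwards [hβB m] with x hx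
      exact hclose m x hx)
  rw [hα, hτ, integral_finsetSum_measure fun k _ => (hνc k).1.smul_measure ENNReal.ofReal_ne_top,
    integral_finsetSum_measure fun m _ => (hβc m).1.smul_measure ENNReal.ofReal_ne_top] at hineq
  simp only [integral_smul_measure, smul_eq_mul] at hineq
  have h1 : ∑ k, ε * a k * (cost p lam (y k) - η) ≤
      ∑ k, (ENNReal.ofReal (ε * a k)).toReal * ∫ x, cost p lam x ∂ν k := by
    refine Finset.sum_le_sum fun k _ => ?_
    rw [ENNReal.toReal_ofReal (mul_nonneg hε.le (ha k))]
    refine mul_le_mul_of_nonneg_left ?_ (mul_nonneg hε.le (ha k))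
    linarith [(abs_le.1 (hνc k).2).1]
  have h2 : ∑ m, (ENNReal.ofReal (ε * b m)).toReal * ∫ x, cost p lam x ∂β m ≤
      ∑ m, ε * b m * ((cost p lam fun i => y (m i) i) + η) := by
    refine Finset.sum_le_sum fun m _ => ?_
    rw [ENNReal.toReal_ofReal (mul_nonneg hε.le (hb m))]
    refine mul_le_mul_of_nonneg_left ?_ (mul_nonneg hε.le (hb m))
    linarith [(abs_le.1 (hβc m).2).2]
  -- The competitor would be cheaper by at least `ε * (Δ - η * S) > 0`.
  have h3 : ∑ k, ε * a k * (cost p lam (y k) - η) -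
      ∑ m, ε * b m * ((cost p lam fun i => y (m i) i) + η) = ε * (Δ - η * S) := by
    have e1 : ∑ k, ε * a k * (cost p lam (y k) - η) =
        ε * ∑ k, a k * cost p lam (y k) - ε * η * ∑ k, a k := by
      rw [Finset.mul_sum, Finset.mul_sum, ← Finset.sum_sub_distrib]
      exact Finset.sum_congr rfl fun k _ => by ring
    have e2 : ∑ m, ε * b m * ((cost p lam fun i => y (m i) i) + η) =
        ε * ∑ m, b m * (cost p lam fun i => y (m i) i) + ε * η * ∑ m, b m := by
      rw [Finset.mul_sum, Finset.mul_sum, ← Finset.sum_add_distrib]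
      exact Finset.sum_congr rfl fun k _ => by ring
    rw [e1, e2, hΔ, hS]
    ring
  have h4 : 0 < ε * (Δ - η * S) := mul_pos hε (by linarith)
  linarith

end Support

end MMOT

namespace MMOT

/-! ### Splitting functions -/

section Splitting

variable {N : ℕ}

/-- Approximate linear programming duality for finite multi-marginal problems. -/
lemma exists_approx_splitting_of_fintype {K : Type*} [Fintype K] [Nonempty K]
    (c : (Fin N → K) → ℝ)
    (H : ∀ (a : K → ℝ) (b : (Fin N → K) → ℝ), (∀ k, 0 ≤ a k) → (∀ m, 0 ≤ b m) →
      (∀ (i : Fin N) (f : K → ℝ), ∑ m, b m * f (m i) = ∑ k, a k * f k) →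
      ∑ k, a k * c (fun _ => k) ≤ ∑ m, b m * c m) {ε : ℝ} (hε : 0 < ε) :
    ∃ u : Fin N → K → ℝ, (∀ m, ∑ i, u i (m i) ≤ c m + ε) ∧
      ∀ k, c (fun _ => k) - ε ≤ ∑ i, u i k := by
  classical
  -- `e m` records the marginals of the Dirac mass at `m`. The vectors `v` pair marginals with
  -- signed costs, adding mass at `m` or removing it from the diagonal at `k`.
  let e : (Fin N → K) → (Fin N → K → ℝ) := fun m i k => if m i = k then 1 else 0
  let v : (Fin N → K) ⊕ K → (Fin N → K → ℝ) × ℝ :=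
    Sum.elim (fun m => (e m, -c m)) (fun k => (-e fun _ => k, c fun _ => k))
  let Φ : ((Fin N → K) ⊕ K → ℝ) →ₗ[ℝ] (Fin N → K → ℝ) × ℝ := Fintype.linearCombination ℝ v
  have hΦ (w) : Φ w = ∑ j, w j • v j := Fintype.linearCombination_apply ℝ v w
  have hT₁ : Convex ℝ (Φ '' stdSimplex ℝ _) := (convex_stdSimplex ℝ _).linear_image Φ
  have hT₂ : IsCompact (Φ '' stdSimplex ℝ _) :=
    (isCompact_stdSimplex ℝ _).image Φ.continuous_of_finiteDimensional
  have hvT (j) : v j ∈ Φ '' stdSimplex ℝ _ :=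
    ⟨Pi.single j 1, single_mem_stdSimplex ℝ j, by
      rw [hΦ, Finset.sum_eq_single j] <;> simp +contextual⟩
  -- A common point would be a pair of weights with equal marginals whose recombination saves at
  -- least `ε`, contrary to `H`.
  have hdisj : Disjoint (Φ '' stdSimplex ℝ _) (({0} : Set (Fin N → K → ℝ)) ×ˢ Set.Ici ε) := by
    rw [Set.disjoint_left]
    rintro _ ⟨w, hw, rfl⟩ ⟨h1, h2⟩
    rw [Set.mem_singleton_iff] at h1
    rw [Set.mem_Ici] at h2
    have hmarg (i : Fin N) (k : K) :
        ∑ m : Fin N → K, w (Sum.inl m) * (if m i = k then 1 else 0) = w (Sum.inr k) := by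
      have := congrFun (congrFun h1 i) k
      rw [hΦ, Fintype.sum_sum_type] at this
      simp only [v, Sum.elim_inl, Sum.elim_inr, Prod.smul_mk, Prod.fst_add, Prod.fst_sum,
        Pi.add_apply, Finset.sum_apply, Pi.smul_apply, Pi.neg_apply, e, smul_eq_mul,
        Pi.zero_apply, mul_neg, Finset.sum_neg_distrib] at this
      simp only [mul_ite, mul_one, mul_zero, Finset.sum_ite_eq', Finset.mem_univ, if_true] at this ⊢
      linarith
    have hcost := H (fun k => w (Sum.inr k)) (fun m => w (Sum.inl m)) (fun k => hw.1 _)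
      (fun m => hw.1 _) (fun i f => by
        simp_rw [← hmarg i, Finset.sum_mul]
        rw [Finset.sum_comm]
        refine Finset.sum_congr rfl fun m _ => ?_
        simp)
    rw [hΦ, Fintype.sum_sum_type] at h2
    simp only [v, Sum.elim_inl, Sum.elim_inr, Prod.smul_mk, Prod.snd_add, Prod.snd_sum,
      smul_eq_mul, mul_neg, Finset.sum_neg_distrib] at h2
    linarith
  obtain ⟨f, r, s, hr, hrs, hs⟩ := geometric_hahn_banach_compact_closed hT₁ hT₂
    ((convex_singleton (0 : Fin N → K → ℝ)).prod (convex_Ici ε))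
    (isClosed_singleton.prod isClosed_Ici) hdisj
  set t := f (0, 1) with ht
  let g : Fin N → K → ℝ := fun i k => f (Pi.single i (Pi.single k 1), 0)
  have hfe (m : Fin N → K) : f (e m, 0) = ∑ i, g i (m i) := by
    have : (e m, (0 : ℝ)) = ∑ i, (Pi.single i (Pi.single (m i) (1 : ℝ)), (0 : ℝ)) := by
      refine Prod.ext ?_ (by simp [Prod.snd_sum])
      rw [Prod.fst_sum]
      funext i k
      simp [e, Finset.sum_apply, Pi.single_apply, eq_comm, ite_apply]
    rw [this, map_sum]
  have hsplit (x : Fin N → K → ℝ) (y : ℝ) : f (x, y) = f (x, 0) + y * t := by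
    have : (x, y) = (x, (0 : ℝ)) + y • ((0 : Fin N → K → ℝ), (1 : ℝ)) := by simp
    rw [this, map_add, map_smul, smul_eq_mul]
  have h1 (m : Fin N → K) : ∑ i, g i (m i) - c m * t < r := by
    have := hr _ (hvT (Sum.inl m))
    simp only [v, Sum.elim_inl] at this
    rw [hsplit, hfe] at this
    linarith
  have h2 (k : K) : -∑ i, g i k + c (fun _ => k) * t < r := by
    have := hr _ (hvT (Sum.inr k))
    simp only [v, Sum.elim_inr] at this
    rw [hsplit, show ((-e fun _ => k, 0) : (Fin N → K → ℝ) × ℝ) = -(e fun _ => k, 0) by simp,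
      map_neg, hfe] at this
    exact this
  have h3 (y : ℝ) (hy : ε ≤ y) : s < y * t := by
    have := hs (0, y) ⟨rfl, hy⟩
    rw [hsplit, show ((0, 0) : (Fin N → K → ℝ) × ℝ) = 0 from rfl, map_zero, zero_add] at this
    exact this
  obtain ⟨k₀⟩ := ‹Nonempty K›
  -- On a diagonal point the two strict bounds have opposite left-hand sides, so they add up to `0 <
  -- 2 * r`. Then `0 < r < ε * t` permits dividing the separating functional by `t`.
  have hr0 : 0 < r := by linarith [h1 fun _ => k₀, h2 k₀]
  have htpos : 0 < t := by
    by_contra! h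
    nlinarith [h3 ε le_rfl]
  have hrt : r < ε * t := hrs.trans (h3 ε le_rfl)
  refine ⟨fun i k => g i k / t, fun m => ?_, fun k => ?_⟩
  · rw [← Finset.sum_div, div_le_iff₀ htpos]
    nlinarith [h1 m]
  · rw [← Finset.sum_div, le_div_iff₀ htpos]
    nlinarith [h2 k]

/-- A cost on a set which no finite rearrangement decreases is split by `N` functions. -/
lemma exists_splitting {X : Type*} [Nonempty X] (hN : N ≠ 0) (c : (Fin N → X) → ℝ)
    (H : ∀ (F : Finset X) (a : F → ℝ) (b : (Fin N → F) → ℝ), (∀ k, 0 ≤ a k) → (∀ m, 0 ≤ b m) →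
      (∀ (i : Fin N) (f : F → ℝ), ∑ m, b m * f (m i) = ∑ k, a k * f k) →
      ∑ k : F, a k * c (fun _ => k) ≤ ∑ m, b m * c (fun i => m i)) :
    ∃ u : Fin N → X → ℝ, (∀ m : Fin N → X, ∑ i, u i (m i) ≤ c m) ∧
      ∀ x, ∑ i, u i x = c fun _ => x := by
  classical
  obtain ⟨x₀⟩ := ‹Nonempty X›
  set c₀ := c fun _ => x₀ with hc₀
  -- A splitting is determined only up to constants with zero sum. Prescribing the value `q` of
  -- every `u i` at `x₀` removes this freedom; testing recombinations of `x` with `x₀` then bounds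
  -- `u i x` by `U i x`, and near equality at `x` bounds it below by `L i x`.
  set q : ℝ := c₀ / N with hq
  have hNq : (N : ℝ) * q = c₀ := mul_div_cancel₀ _ (Nat.cast_ne_zero.2 hN)
  let U : Fin N → X → ℝ := fun i x => c (Function.update (fun _ => x₀) i x) + 1 - c₀ + q
  let L : Fin N → X → ℝ := fun i x => c (fun _ => x) - 1 - ∑ j, U j x + U i x
  have approx (F : Finset X) (ε : ℝ) (hε : 0 < ε) (hε1 : ε ≤ 1) : ∃ u : Fin N → X → ℝ,
      (∀ m : Fin N → X, (∀ i, m i ∈ F) → ∑ i, u i (m i) ≤ c m + ε) ∧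
      (∀ x ∈ F, c (fun _ => x) - ε ≤ ∑ i, u i x) ∧ ∀ x ∈ F, ∀ i, u i x ∈ Set.Icc (L i x) (U i x) := by
    have hx₀ : x₀ ∈ insert x₀ F := Finset.mem_insert_self _ _
    have : Nonempty (insert x₀ F : Finset X) := ⟨⟨x₀, hx₀⟩⟩
    -- Tolerance `ε / 2` suffices because shifting the sum at `x₀` to exactly `c₀` costs at most
    -- another `ε / 2`.
    obtain ⟨u, hu1, hu2⟩ := exists_approx_splitting_of_fintype
      (fun m : Fin N → (insert x₀ F : Finset X) => c fun i => m i) (H (insert x₀ F)) (half_pos hε)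
    let w : Fin N → X → ℝ := fun i x =>
      if hx : x ∈ insert x₀ F then u i ⟨x, hx⟩ - u i ⟨x₀, hx₀⟩ + q else 0
    have hwsum (m : Fin N → X) (hm : ∀ i, m i ∈ insert x₀ F) :
        ∑ i, w i (m i) = ∑ i, u i ⟨m i, hm i⟩ - ∑ i, u i ⟨x₀, hx₀⟩ + c₀ := by
      simp only [w, hm, dif_pos, Finset.sum_add_distrib, Finset.sum_sub_distrib]
      simp [hNq]
    have hw1 (m : Fin N → X) (hm : ∀ i, m i ∈ insert x₀ F) : ∑ i, w i (m i) ≤ c m + ε := by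
      rw [hwsum m hm]
      have h1 := hu1 fun i => ⟨m i, hm i⟩
      have h2 := hu2 ⟨x₀, hx₀⟩
      simp only at h1 h2
      linarith
    have hw2 (x : X) (hx : x ∈ insert x₀ F) : c (fun _ => x) - ε ≤ ∑ i, w i x := by
      rw [hwsum (fun _ => x) fun _ => hx]
      have h1 := hu1 fun _ => ⟨x₀, hx₀⟩
      have h2 := hu2 ⟨x, hx⟩
      simp only at h1 h2
      linarith
    have hwx₀ (i) : w i x₀ = q := by simp [w]
    have hwU (x : X) (hx : x ∈ insert x₀ F) (i) : w i x ≤ U i x := by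
      have h := hw1 (Function.update (fun _ => x₀) i x) fun j => by
        by_cases hj : j = i
        · subst hj; simpa using hx
        · simp [hj]
      have h' : ∑ j, w j (Function.update (fun _ => x₀) i x j) = w i x + (c₀ - q) := by
        rw [← Finset.add_sum_erase _ _ (Finset.mem_univ i)]
        congr 1
        · simp
        · have h1 : ∑ j ∈ Finset.univ.erase i, w j (Function.update (fun _ => x₀) i x j) =
              ∑ j ∈ Finset.univ.erase i, q := Finset.sum_congr rfl fun j hj => by
            rw [Function.update_of_ne (Finset.ne_of_mem_erase hj), hwx₀]
          have h2 := Finset.add_sum_erase Finset.univ (fun _ : Fin N => q) (Finset.mem_univ i)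
          have h3 : ∑ _j : Fin N, q = c₀ := by simp [hNq]
          rw [h1]
          linarith
      rw [h'] at h
      simp only [U]
      linarith
    refine ⟨w, fun m hm => hw1 m fun i => Finset.mem_insert_of_mem (hm i),
      fun x hx => hw2 x (Finset.mem_insert_of_mem hx), fun x hx i => ?_⟩
    have hx' := Finset.mem_insert_of_mem (b := x₀) hx
    refine ⟨?_, hwU x hx' i⟩
    have h1 := hw2 x hx'
    have h2 : ∑ j ∈ Finset.univ.erase i, w j x ≤ ∑ j ∈ Finset.univ.erase i, U j x :=
      Finset.sum_le_sum fun j _ => hwU x hx' j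
    have h3 := Finset.add_sum_erase Finset.univ (fun j => w j x) (Finset.mem_univ i)
    have h4 := Finset.add_sum_erase Finset.univ (fun j => U j x) (Finset.mem_univ i)
    simp only [L]
    linarith
  let Box : Set (Fin N → X → ℝ) := Set.univ.pi fun i => Set.univ.pi fun x => Set.Icc (L i x) (U i x)
  have hBox : IsCompact Box := isCompact_univ_pi fun i => isCompact_univ_pi fun x => isCompact_Icc
  -- Each index imposes finitely many points and one tolerance. These closed subsets of a compact
  -- box are nonempty and decreasing, so they have a common point.
  let S : Finset X × ℕ → Set (Fin N → X → ℝ) := fun Fn =>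
    Box ∩ ((⋂ (m : Fin N → X) (_ : ∀ i, m i ∈ Fn.1),
        {u | ∑ i, u i (m i) ≤ c m + 1 / ((Fn.2 : ℝ) + 1)}) ∩
      ⋂ (x : X) (_ : x ∈ Fn.1), {u | c (fun _ => x) - 1 / ((Fn.2 : ℝ) + 1) ≤ ∑ i, u i x})
  have hScl (Fn) : IsClosed (S Fn) := by
    refine hBox.isClosed.inter (IsClosed.inter ?_ ?_)
    · exact isClosed_iInter fun m => isClosed_iInter fun _ =>
        isClosed_le (by fun_prop) continuous_const
    · exact isClosed_iInter fun m => isClosed_iInter fun _ =>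
        isClosed_le continuous_const (by fun_prop)
  have hSanti : Antitone S := by
    intro A B hAB u hu
    have hn : 1 / ((B.2 : ℝ) + 1) ≤ 1 / ((A.2 : ℝ) + 1) :=
      one_div_le_one_div_of_le (by positivity) (by simpa using hAB.2)
    refine ⟨hu.1, ?_, ?_⟩
    · refine Set.mem_iInter₂.2 fun m hm => ?_
      have : ∑ i, u i (m i) ≤ c m + 1 / ((B.2 : ℝ) + 1) :=
        Set.mem_iInter₂.1 hu.2.1 m fun i => hAB.1 (hm i)
      exact this.trans (by linarith)
    · refine Set.mem_iInter₂.2 fun x hx => ?_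
      have : c (fun _ => x) - 1 / ((B.2 : ℝ) + 1) ≤ ∑ i, u i x :=
        Set.mem_iInter₂.1 hu.2.2 x (hAB.1 hx)
      exact le_trans (by linarith) this
  have hSne (Fn) : (S Fn).Nonempty := by
    obtain ⟨u, h1, h2, h3⟩ := approx Fn.1 (1 / ((Fn.2 : ℝ) + 1)) (by positivity)
      (by rw [div_le_one (by positivity)]; linarith [(Fn.2.cast_nonneg : (0 : ℝ) ≤ Fn.2)])
    have hLU (x : X) (i) : L i x ≤ U i x := by
      obtain ⟨w, -, -, hw⟩ := approx {x} 1 one_pos le_rfl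
      exact (hw x (Finset.mem_singleton_self x) i).1.trans (hw x (Finset.mem_singleton_self x) i).2
    -- Off the finite set only membership in the box matters, so the upper endpoint will do.
    refine ⟨fun i x => if x ∈ Fn.1 then u i x else U i x, ?_, ?_, ?_⟩
    · intro i _ x _
      by_cases hx : x ∈ Fn.1
      · simpa [hx] using h3 x hx i
      · simpa [hx] using hLU x i
    · refine Set.mem_iInter₂.2 fun m hm => ?_
      simpa [hm] using h1 m hm
    · refine Set.mem_iInter₂.2 fun x hx => ?_
      simpa [hx] using h2 x hx
  obtain ⟨u, hu⟩ := IsCompact.nonempty_iInter_of_directed_nonempty_isCompact_isClosed S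
    hSanti.directed_ge hSne (fun Fn => hBox.of_isClosed_subset (hScl Fn) Set.inter_subset_left) hScl
  rw [Set.mem_iInter] at hu
  have hup (m : Fin N → X) : ∑ i, u i (m i) ≤ c m := by
    have hlim := (tendsto_const_nhds (x := c m)).add
      (tendsto_one_div_add_atTop_nhds_zero_nat (𝕜 := ℝ))
    rw [add_zero] at hlim
    refine ge_of_tendsto' hlim fun n => ?_
    exact Set.mem_iInter₂.1 (hu (Finset.univ.image m, n)).2.1 m fun i => by simp
  refine ⟨u, hup, fun x => le_antisymm (hup fun _ => x) ?_⟩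
  have hlim := (tendsto_const_nhds (x := c fun _ => x)).sub
    (tendsto_one_div_add_atTop_nhds_zero_nat (𝕜 := ℝ))
  rw [sub_zero] at hlim
  refine le_of_tendsto' hlim fun n => ?_
  exact Set.mem_iInter₂.1 (hu ({x}, n)).2.2 x (Finset.mem_singleton_self x)

end Splitting

end MMOT

namespace MMOT

/-! ### Infimal convolutions with a power of the norm -/

section Conjugate

variable {d : ℕ} {p l : ℝ}

/-- Bernoulli's inequality at `s / t - 1` is the tangent line inequality for the convex function `r
^ p` at `t`. -/
lemma rpow_sub_rpow_le (hp : 1 < p) {s t T : ℝ} (hs : 0 ≤ s) (hst : s ≤ t) (htT : t ≤ T) :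
    t ^ p - s ^ p ≤ p * T ^ (p - 1) * (t - s) := by
  rcases (hs.trans hst).eq_or_lt with rfl | ht
  · obtain rfl : s = 0 := le_antisymm hst hs
    simp
  have h1 := one_add_mul_self_le_rpow_one_add (s := s / t - 1) (by
    have := div_nonneg hs ht.le; linarith) hp.le
  rw [add_sub_cancel, Real.div_rpow hs ht.le, le_div_iff₀ (Real.rpow_pos_of_pos ht p)] at h1
  have h2 : t ^ p = t ^ (p - 1) * t := by
    rw [Real.rpow_sub_one ht.ne', div_mul_cancel₀ _ ht.ne']
  have h3 : (1 + p * (s / t - 1)) * t ^ p = t ^ p - p * t ^ (p - 1) * (t - s) := by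
    rw [h2]; field_simp; ring
  have h4 : t ^ (p - 1) ≤ T ^ (p - 1) := Real.rpow_le_rpow ht.le htT (by linarith)
  have h5 : p * t ^ (p - 1) * (t - s) ≤ p * T ^ (p - 1) * (t - s) := by
    have : 0 ≤ t - s := by linarith
    gcongr
  linarith

lemma rpow_le_rpow_add (hp : 1 < p) {s t T : ℝ} (hs : 0 ≤ s) (hsT : s ≤ T) (ht : 0 ≤ t)
    (htT : t ≤ T) : t ^ p ≤ s ^ p + p * T ^ (p - 1) * |t - s| := by
  have hT : 0 ≤ T ^ (p - 1) := Real.rpow_nonneg (hs.trans hsT) _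
  rcases le_total s t with h | h
  · rw [abs_of_nonneg (by linarith)]
    linarith [rpow_sub_rpow_le hp hs h htT]
  · have := Real.rpow_le_rpow ht h (by linarith : 0 ≤ p)
    have : 0 ≤ p * T ^ (p - 1) * |t - s| := by positivity
    linarith

/-- For `p > 1` the lower bound is unbounded in `r`: a step of fixed length `R` towards a distant
centre lowers the power by an arbitrarily large amount. -/
lemma mul_rpow_sub_one_le (hp : 1 < p) {r R : ℝ} (hR : 0 < R) (hr : R ≤ r) :
    R * r ^ (p - 1) ≤ r ^ p - (r - R) ^ p := by
  have hr0 : 0 < r := hR.trans_le hr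
  have h2 : r ^ p = r ^ (p - 1) * r := by
    rw [Real.rpow_sub_one hr0.ne', div_mul_cancel₀ _ hr0.ne']
  have h3 : (r - R) ^ p ≤ r ^ (p - 1) * (r - R) := by
    rcases hr.eq_or_lt with rfl | h
    · rw [sub_self, Real.zero_rpow (by linarith), mul_zero]
    · have h4 : (r - R) ^ p = (r - R) ^ (p - 1) * (r - R) := by
        rw [Real.rpow_sub_one (by linarith), div_mul_cancel₀ _ (by linarith)]
      rw [h4]
      have : (r - R) ^ (p - 1) ≤ r ^ (p - 1) :=
        Real.rpow_le_rpow (by linarith) (by linarith) (by linarith)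
      exact mul_le_mul_of_nonneg_right this (by linarith)
  nlinarith

/-- An infimum of translates of `l ‖·‖ ^ p` which is bounded below on a ball is Lipschitz on the
concentric ball of half the radius. -/
lemma exists_lipschitzOnWith_iInf {ι : Type*} [Nonempty ι] (hp : 1 < p) (hl : 0 < l)
    (w : ι → Space d) (b : ι → ℝ) {x₀ : Space d} {R M : ℝ} (hR : 0 < R)
    (hM : ∀ x ∈ Metric.ball x₀ (2 * R), ∀ i, -M ≤ l * ‖x - w i‖ ^ p - b i) :
    ∃ C, LipschitzOnWith C (fun x => ⨅ i, (l * ‖x - w i‖ ^ p - b i)) (Metric.ball x₀ R) := by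
  obtain ⟨i₀⟩ := ‹Nonempty ι›
  -- `A - 1` bounds the infimum on the ball; the extra `1` leaves room for approximate minimizers.
  set A : ℝ := l * (R + ‖x₀ - w i₀‖) ^ p - b i₀ + 1 with hA
  have hsub : Metric.ball x₀ R ⊆ Metric.ball x₀ (2 * R) := Metric.ball_subset_ball (by linarith)
  have hbdd (x) (hx : x ∈ Metric.ball x₀ R) :
      BddBelow (Set.range fun i => l * ‖x - w i‖ ^ p - b i) :=
    ⟨-M, by rintro _ ⟨i, rfl⟩; exact hM x (hsub hx) i⟩
  have hle (x) (hx : x ∈ Metric.ball x₀ R) : ⨅ i, (l * ‖x - w i‖ ^ p - b i) ≤ A - 1 := by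
    refine (ciInf_le (hbdd x hx) i₀).trans ?_
    have h1 : ‖x - w i₀‖ ≤ R + ‖x₀ - w i₀‖ := by
      have := norm_sub_le_norm_sub_add_norm_sub x x₀ (w i₀)
      have := mem_ball_iff_norm.1 hx
      linarith
    have := Real.rpow_le_rpow (norm_nonneg _) h1 (by linarith : 0 ≤ p)
    rw [hA]
    nlinarith
  obtain ⟨R₁, hR₁⟩ := Filter.eventually_atTop.1
    ((tendsto_rpow_atTop (by linarith : 0 < p - 1)).eventually_gt_atTop ((A + M) / (l * R)))
  -- Almost optimal centres are at bounded distance: from a far one, moving `x` by `R` towards `w i`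
  -- stays in the larger ball but would push the value below `-M`.
  have hnear (x) (hx : x ∈ Metric.ball x₀ R) (i) (hi : l * ‖x - w i‖ ^ p - b i ≤ A) :
      ‖x - w i‖ ≤ max R R₁ := by
    by_contra! h
    obtain ⟨hRr, hR₁r⟩ := max_lt_iff.1 h
    set r := ‖x - w i‖ with hr
    have hr0 : 0 < r := hR.trans hRr
    have h1 := hR₁ r hR₁r.le
    rw [div_lt_iff₀ (by positivity)] at h1
    set x' := x - (R / r) • (x - w i) with hx'
    have hx'x : ‖x' - x‖ = R := by
      rw [hx', sub_sub_cancel_left, norm_neg, norm_smul, Real.norm_of_nonneg (by positivity), ← hr,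
        div_mul_cancel₀ _ hr0.ne']
    have hx'b : x' ∈ Metric.ball x₀ (2 * R) := by
      rw [mem_ball_iff_norm] at hx ⊢
      have := norm_sub_le_norm_sub_add_norm_sub x' x x₀
      linarith
    have hx'w : ‖x' - w i‖ = r - R := by
      have : x' - w i = (1 - R / r) • (x - w i) := by rw [hx']; module
      rw [this, norm_smul, ← hr, Real.norm_of_nonneg, sub_mul, div_mul_cancel₀ _ hr0.ne', one_mul]
      rw [sub_nonneg, div_le_one hr0]
      exact hRr.le
    have h2 := hM x' hx'b i
    rw [hx'w] at h2
    have h3 := mul_le_mul_of_nonneg_left (mul_rpow_sub_one_le hp hR hRr.le) hl.le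
    nlinarith
  set T := max R R₁ + 2 * R with hT
  have hT0 : 0 ≤ T := by have := le_max_left R R₁; linarith
  set C : ℝ := l * (p * T ^ (p - 1)) with hC
  have hC0 : 0 ≤ C := by have := Real.rpow_nonneg hT0 (p - 1); positivity
  refine ⟨C.toNNReal, LipschitzOnWith.of_le_add_mul _ fun x hx y hy => ?_⟩
  rw [Real.coe_toNNReal _ hC0]
  refine le_of_forall_pos_le_add fun ε hε => ?_
  obtain ⟨i, hi⟩ := exists_lt_of_ciInf_lt (lt_add_of_pos_right
    (⨅ i, (l * ‖y - w i‖ ^ p - b i)) (lt_min hε one_pos))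
  have hiA : l * ‖y - w i‖ ^ p - b i ≤ A := by
    linarith [hle y hy, min_le_right ε 1]
  have hy1 := hnear y hy i hiA
  have hxy : |‖x - w i‖ - ‖y - w i‖| ≤ dist x y := by
    rw [dist_eq_norm]
    simpa using abs_norm_sub_norm_le (x - w i) (y - w i)
  have hxyR : dist x y ≤ 2 * R := by
    have := dist_triangle_right x y x₀
    have := Metric.mem_ball.1 hx
    have := Metric.mem_ball.1 hy
    linarith
  have hx1 : ‖x - w i‖ ≤ T := by linarith [(abs_le.1 hxy).2]
  have h1 := rpow_le_rpow_add hp (norm_nonneg (y - w i)) (by linarith) (norm_nonneg (x - w i)) hx1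
  have hpT : 0 ≤ p * T ^ (p - 1) := by have := Real.rpow_nonneg hT0 (p - 1); positivity
  calc ⨅ i, (l * ‖x - w i‖ ^ p - b i) ≤ l * ‖x - w i‖ ^ p - b i := ciInf_le (hbdd x hx) i
    _ ≤ l * (‖y - w i‖ ^ p + p * T ^ (p - 1) * dist x y) - b i := by
        have := mul_le_mul_of_nonneg_left hxy hpT
        have := mul_le_mul_of_nonneg_left (h1.trans (add_le_add_right this _)) hl.le
        linarith
    _ = (l * ‖y - w i‖ ^ p - b i) + C * dist x y := by rw [hC]; ring
    _ ≤ (⨅ i, (l * ‖y - w i‖ ^ p - b i)) + C * dist x y + ε := by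
        linarith [min_le_left ε 1]

lemma conjugate_le (ψ : Space d → ℝ) (x z : Space d) :
    conjugate l p ψ x ≤ ((l * ‖x - z‖ ^ p - ψ z : ℝ) : EReal) :=
  iInf_le _ z

lemma conjugate_ne_top (ψ : Space d → ℝ) (x : Space d) : conjugate l p ψ x ≠ ⊤ :=
  ne_top_of_le_ne_top (EReal.coe_ne_top _) (conjugate_le ψ x 0)

lemma measurable_conjugate (hp : 1 < p) (ψ : Space d → ℝ) : Measurable (conjugate l p ψ) := by
  refine UpperSemicontinuous.measurable (upperSemicontinuous_iInf fun z => ?_)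
  refine Continuous.upperSemicontinuous (continuous_coe_real_ereal.comp ?_)
  have : Continuous fun x : Space d => ‖x - z‖ ^ p :=
    (continuous_id.sub continuous_const).norm.rpow_const fun _ => Or.inr (by linarith)
  fun_prop

lemma exists_lower_bound_of_conjugate_ne_bot {ψ : Space d → ℝ} {x : Space d}
    (h : conjugate l p ψ x ≠ ⊥) : ∃ B : ℝ, ∀ z, B ≤ l * ‖x - z‖ ^ p - ψ z := by
  refine ⟨(conjugate l p ψ x).toReal, fun z => ?_⟩
  rw [← EReal.coe_le_coe_iff, EReal.coe_toReal (conjugate_ne_top ψ x) h]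
  exact conjugate_le ψ x z

/-- The lower bound is essential: a real infimum of a family unbounded below takes the default value
`0`, whereas the conjugate is `⊥`. -/
lemma conjugate_eq_coe_iInf {ψ : Space d → ℝ} {x : Space d} {B : ℝ}
    (h : ∀ z, B ≤ l * ‖x - z‖ ^ p - ψ z) :
    conjugate l p ψ x = ((⨅ z, (l * ‖x - z‖ ^ p - ψ z) : ℝ) : EReal) := by
  have hbdd : BddBelow (Set.range fun z => l * ‖x - z‖ ^ p - ψ z) :=
    ⟨B, by rintro _ ⟨z, rfl⟩; exact h z⟩
  have hB : (B : EReal) ≤ conjugate l p ψ x := le_iInf fun z => EReal.coe_le_coe_iff.2 (h z)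
  have hbot : conjugate l p ψ x ≠ ⊥ := fun h0 => by simp [h0] at hB
  refine le_antisymm ?_ (le_iInf fun z => EReal.coe_le_coe_iff.2 (ciInf_le hbdd z))
  rw [← EReal.coe_toReal (conjugate_ne_top ψ x) hbot, EReal.coe_le_coe_iff]
  refine le_ciInf fun z => ?_
  rw [← EReal.coe_le_coe_iff, EReal.coe_toReal (conjugate_ne_top ψ x) hbot]
  exact conjugate_le ψ x z

/-- A conjugate function is bounded below near every point which is not separated from its domain
by a hyperplane. -/
lemma exists_ball_lower_bound (hp : 1 < p) (hl : 0 < l) {ψ : Space d → ℝ} {C : ℝ}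
    (hψ : ∀ z, |ψ z| ≤ C * (1 + ‖z‖ ^ p)) {x₀ : Space d}
    (hdom : ∀ e : Space d, ‖e‖ = 1 → ∃ y, conjugate l p ψ y ≠ ⊥ ∧ 0 < inner ℝ (y - x₀) e) :
    ∃ R > 0, ∃ M : ℝ, ∀ x ∈ Metric.ball x₀ R, ∀ z, -M ≤ l * ‖x - z‖ ^ p - ψ z := by
  -- Failure yields `x n → x₀` and `z n` with values below `-n`. Growth of `ψ` forces `z n` to
  -- infinity, along a subsequence in a direction `e₀`. A domain point `y` ahead of `x₀` in that
  -- direction is eventually closer to `z n` than `x n` is, so the values at `y` are unbounded below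
  -- too.
  by_contra! hcon
  choose! x hx z hz using fun n : ℕ => hcon (1 / ((n : ℝ) + 1)) (by positivity) n
  have hxlim : Filter.Tendsto x Filter.atTop (𝓝 x₀) := by
    rw [tendsto_iff_dist_tendsto_zero]
    exact squeeze_zero (fun _ => dist_nonneg) (fun n => (Metric.mem_ball.1 (hx n)).le)
      tendsto_one_div_add_atTop_nhds_zero_nat
  have hC : 0 ≤ C := by
    have := (abs_nonneg _).trans (hψ 0)
    rw [norm_zero, Real.zero_rpow (by linarith)] at this
    linarith
  have hzlim : Filter.Tendsto (fun n => ‖z n‖) Filter.atTop Filter.atTop := by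
    rw [Filter.tendsto_atTop]
    intro B
    filter_upwards [Filter.eventually_gt_atTop ⌈C * (1 + max B 0 ^ p)⌉₊] with n hn
    by_contra! h
    have h1 : ‖z n‖ ^ p ≤ max B 0 ^ p :=
      Real.rpow_le_rpow (norm_nonneg _) (h.le.trans (le_max_left _ _)) (by linarith)
    have h2 := Nat.lt_of_ceil_lt hn
    have h3 := (abs_le.1 (hψ (z n))).2
    have h4 : 0 ≤ l * ‖x n - z n‖ ^ p := by positivity
    have h5 := hz n
    have h6 : C * (1 + ‖z n‖ ^ p) ≤ C * (1 + max B 0 ^ p) := by gcongr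
    linarith
  set r : ℕ → ℝ := fun n => ‖z n - x n‖ with hr
  have hrlim : Filter.Tendsto r Filter.atTop Filter.atTop := by
    refine Filter.tendsto_atTop_mono (f := fun n => ‖z n‖ + -‖x n‖) (fun n => ?_)
      (Filter.tendsto_atTop_add_right_of_le' _ (-(‖x₀‖ + 1)) hzlim ?_)
    · have := norm_sub_norm_le (z n) (x n)
      simp only [hr]
      linarith
    · filter_upwards [hxlim.norm.eventually_lt_const (lt_add_one ‖x₀‖)] with n hn
      linarith
  set e : ℕ → Space d := fun n => (r n)⁻¹ • (z n - x n) with he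
  have he1 (n : ℕ) (hn : 0 < r n) : ‖e n‖ = 1 := by
    simp only [he]
    rw [norm_smul, norm_inv, Real.norm_of_nonneg hn.le]
    exact inv_mul_cancel₀ hn.ne'
  have hemem (n : ℕ) : e n ∈ Metric.closedBall (0 : Space d) 1 := by
    rw [mem_closedBall_zero_iff]
    rcases (norm_nonneg (z n - x n)).eq_or_lt with h | h
    · have h0 : r n = 0 := h.symm
      simp [he, h0]
    · exact (he1 n h).le
  obtain ⟨e₀, -, σ, hσ, hlim⟩ := (isCompact_closedBall (0 : Space d) 1).tendsto_subseq hemem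
  have he₀ : ‖e₀‖ = 1 := by
    refine tendsto_nhds_unique hlim.norm (tendsto_const_nhds.congr' ?_)
    filter_upwards [(hrlim.comp hσ.tendsto_atTop).eventually_gt_atTop 0] with n hn
    exact (he1 _ hn).symm
  obtain ⟨y, hy, hpos⟩ := hdom e₀ he₀
  obtain ⟨B, hB⟩ := exists_lower_bound_of_conjugate_ne_bot hy
  -- The expression is `‖y - z‖ ^ 2 - ‖x - z‖ ^ 2` along the subsequence, expanded with `z - x = r •
  -- e`.
  have hylim : Filter.Tendsto (fun n => ‖y - x (σ n)‖ ^ 2 -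
      2 * r (σ n) * inner ℝ (y - x (σ n)) (e (σ n))) Filter.atTop Filter.atBot := by
    have hx' := hxlim.comp hσ.tendsto_atTop
    have h1 : Filter.Tendsto (fun n => ‖y - x (σ n)‖ ^ 2) Filter.atTop (𝓝 (‖y - x₀‖ ^ 2)) :=
      ((tendsto_const_nhds.sub hx').norm).pow 2
    have h2 : Filter.Tendsto (fun n => inner ℝ (y - x (σ n)) (e (σ n))) Filter.atTop
        (𝓝 (inner ℝ (y - x₀) e₀)) := (tendsto_const_nhds.sub hx').inner hlim
    have h3 : Filter.Tendsto (fun n => 2 * r (σ n) * inner ℝ (y - x (σ n)) (e (σ n)))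
        Filter.atTop Filter.atTop :=
      ((hrlim.comp hσ.tendsto_atTop).const_mul_atTop two_pos).atTop_mul_pos hpos h2
    exact h1.add_atBot (Filter.tendsto_neg_atTop_atBot.comp h3)
  have hev := ((hylim.eventually_le_atBot 0).and
    ((hrlim.comp hσ.tendsto_atTop).eventually_gt_atTop 0)).and
    (Filter.eventually_gt_atTop ⌈-B⌉₊)
  obtain ⟨n, ⟨hn1, hn2⟩, hn3⟩ := hev.exists
  have hn2' : 0 < r (σ n) := hn2
  have hze : z (σ n) - x (σ n) = r (σ n) • e (σ n) := by
    simp only [he]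
    rw [smul_smul, mul_inv_cancel₀ hn2'.ne', one_smul]
  have hsq : ‖y - z (σ n)‖ ^ 2 ≤ ‖x (σ n) - z (σ n)‖ ^ 2 := by
    have h1 : y - z (σ n) = (y - x (σ n)) - r (σ n) • e (σ n) := by rw [← hze]; abel
    rw [h1, norm_sub_sq_real, inner_smul_right, ← hze, norm_sub_rev (x (σ n))]
    linarith
  have hle := Real.rpow_le_rpow (norm_nonneg _)
    ((sq_le_sq₀ (norm_nonneg _) (norm_nonneg _)).1 hsq) (by linarith : 0 ≤ p)
  have h1 := hB (z (σ n))
  have h2 := hz (σ n)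
  have h3 := Nat.lt_of_ceil_lt hn3
  have h4 : (n : ℝ) ≤ σ n := by exact_mod_cast hσ.id_le n
  have h5 := mul_le_mul_of_nonneg_left hle hl.le
  linarith

/-- A function `ψ^{l,p}` which is finite almost everywhere for `μ` is differentiable almost
everywhere in the convex hull of the support of `μ`. -/
lemma ae_eDifferentiableAt_conjugate (hp : 1 < p) (hl : 0 < l) {ψ : Space d → ℝ}
    (hψ : ψ ∈ growthSpace p) {μ : Measure (Space d)} (hfin : ∀ᵐ x ∂μ, conjugate l p ψ x ≠ ⊥) :
    ∀ᵐ x : Space d, x ∈ convexHull ℝ μ.support → EDifferentiableAt (conjugate l p ψ) x := by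
  obtain ⟨-, C, hC⟩ := hψ
  have hlocal (x₀) (hx₀ : x₀ ∈ interior (convexHull ℝ μ.support)) :
      ∃ R > 0, ∃ M : ℝ, ∀ x ∈ Metric.ball x₀ R, ∀ z, -M ≤ l * ‖x - z‖ ^ p - ψ z := by
    refine exists_ball_lower_bound hp hl hC fun e he => ?_
    -- Otherwise the domain, hence the support and its convex hull, lies in the closed half-space
    -- behind `x₀`, which is impossible at an interior point of the hull.
    by_contra! hcon
    have hcl : IsClosed {y : Space d | inner ℝ e y ≤ inner ℝ e x₀} :=
      isClosed_le (by fun_prop) continuous_const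
    have hmem : {y : Space d | inner ℝ e y ≤ inner ℝ e x₀} ∈ ae μ := by
      filter_upwards [hfin] with y hy
      have := hcon y hy
      rw [inner_sub_left, real_inner_comm, real_inner_comm e x₀] at this
      simpa using this
    have hconv : Convex ℝ {y : Space d | inner ℝ e y ≤ inner ℝ e x₀} :=
      convex_halfSpace_le (IsLinearMap.mk (inner_add_right e) fun c y => inner_smul_right e y c) _
    have hsub := convexHull_min (Measure.support_subset_of_isClosed hcl hmem) hconv
    have hcont : ContinuousAt (fun t : ℝ => x₀ + t • e) 0 := by fun_prop
    have hev : ∀ᶠ t in 𝓝[>] (0 : ℝ), x₀ + t • e ∈ convexHull ℝ μ.support := by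
      refine nhdsWithin_le_nhds (hcont.eventually_mem ?_)
      simpa using mem_interior_iff_mem_nhds.1 hx₀
    obtain ⟨t, ht, ht0⟩ := (hev.and self_mem_nhdsWithin).exists
    have h1 : inner ℝ e (x₀ + t • e) ≤ inner ℝ e x₀ := hsub ht
    rw [inner_add_right, inner_smul_right, real_inner_self_eq_norm_sq, he] at h1
    have : (0 : ℝ) < t := ht0
    linarith
  have hint : ∀ᵐ x : Space d, x ∈ interior (convexHull ℝ μ.support) →
      EDifferentiableAt (conjugate l p ψ) x := by
    rw [ae_iff]
    refine measure_null_of_locally_null _ fun x₀ hx₀ => ?_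
    obtain ⟨hx₀, -⟩ := Classical.not_imp.1 hx₀
    obtain ⟨R, hR, M, hM⟩ := hlocal x₀ hx₀
    obtain ⟨L, hL⟩ := exists_lipschitzOnWith_iInf hp hl (fun z : Space d => z) ψ
      (x₀ := x₀) (R := R / 2) (M := M) (half_pos hR) (by rwa [mul_div_cancel₀ R two_ne_zero])
    -- Rademacher's theorem.
    have hae := hL.ae_differentiableWithinAt_of_mem (μ := volume)
    rw [ae_iff] at hae
    refine ⟨_, inter_mem_nhdsWithin _ (Metric.ball_mem_nhds x₀ (half_pos hR)),
      measure_mono_null ?_ hae⟩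
    rintro x ⟨hx1, hx2⟩ hx3
    refine hx1 fun _ => ⟨_, ?_, (hx3 hx2).differentiableAt (Metric.isOpen_ball.mem_nhds hx2)⟩
    filter_upwards [Metric.isOpen_ball.mem_nhds hx2] with y hy
    exact conjugate_eq_coe_iInf (hM y (Metric.ball_subset_ball (by linarith) hy))
  have hfr : ∀ᵐ x : Space d, x ∉ frontier (convexHull ℝ μ.support) :=
    measure_eq_zero_iff_ae_notMem.1 ((convex_convexHull ℝ _).addHaar_frontier volume)
  filter_upwards [hint, hfr] with x h1 h2 hx
  refine h1 ?_
  by_contra h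
  exact h2 ⟨subset_closure hx, h⟩

end Conjugate

end MMOT

namespace MMOT

/-! ### The potentials -/

section Growth

variable {d : ℕ} {p : ℝ}

/-- Functions of at most `p`-growth. -/
def growthSubmodule (d : ℕ) (p : ℝ) : Submodule ℝ (Space d → ℝ) where
  carrier := {f | ∃ C : ℝ, ∀ x, |f x| ≤ C * (1 + ‖x‖ ^ p)}
  zero_mem' := ⟨0, by simp⟩
  add_mem' := by
    rintro f g ⟨C, hC⟩ ⟨D, hD⟩
    exact ⟨C + D, fun x => (abs_add_le _ _).trans (by rw [add_mul]; exact add_le_add (hC x) (hD x))⟩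
  smul_mem' := by
    rintro c f ⟨C, hC⟩
    refine ⟨|c| * C, fun x => ?_⟩
    rw [Pi.smul_apply, smul_eq_mul, abs_mul, mul_assoc]
    exact mul_le_mul_of_nonneg_left (hC x) (abs_nonneg c)

lemma const_mem_growthSubmodule (c : ℝ) : (fun _ => c) ∈ growthSubmodule d p := by
  refine ⟨|c|, fun x => ?_⟩
  have : 0 ≤ ‖x‖ ^ p := by positivity
  nlinarith [abs_nonneg c]

lemma norm_sub_rpow_mem_growthSubmodule (hp : 1 < p) (w : Space d) :
    (fun x => ‖x - w‖ ^ p) ∈ growthSubmodule d p := by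
  refine ⟨2 ^ p * (1 + ‖w‖ ^ p), fun x => ?_⟩
  have hp0 : 0 ≤ p := by linarith
  have hx : 0 ≤ ‖x‖ ^ p := by positivity
  have hw : 0 ≤ ‖w‖ ^ p := by positivity
  have hmax : max ‖x‖ ‖w‖ ^ p ≤ ‖x‖ ^ p + ‖w‖ ^ p := by
    rcases max_cases ‖x‖ ‖w‖ with h | h <;> rw [h.1] <;> linarith
  rw [abs_of_nonneg (by positivity)]
  calc ‖x - w‖ ^ p ≤ (2 * max ‖x‖ ‖w‖) ^ p := by
        refine Real.rpow_le_rpow (norm_nonneg _) ((norm_sub_le x w).trans ?_) hp0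
        linarith [le_max_left ‖x‖ ‖w‖, le_max_right ‖x‖ ‖w‖]
    _ = 2 ^ p * max ‖x‖ ‖w‖ ^ p := Real.mul_rpow (by norm_num) (by positivity)
    _ ≤ 2 ^ p * ((1 + ‖w‖ ^ p) * (1 + ‖x‖ ^ p)) := by
        gcongr
        nlinarith [mul_nonneg hx hw]
    _ = _ := by ring

lemma mem_growthSubmodule_of_le_of_le {f g h : Space d → ℝ} (hf : f ∈ growthSubmodule d p)
    (hg : g ∈ growthSubmodule d p) (hfh : ∀ x, f x ≤ h x) (hhg : ∀ x, h x ≤ g x) :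
    h ∈ growthSubmodule d p := by
  obtain ⟨C, hC⟩ := hf
  obtain ⟨D, hD⟩ := hg
  refine ⟨C + D, fun x => ?_⟩
  rw [add_mul, abs_le]
  have h1 := abs_le.1 (hC x)
  have h2 := abs_le.1 (hD x)
  have h3 := (abs_nonneg _).trans (hC x)
  have h4 := (abs_nonneg _).trans (hD x)
  constructor <;> linarith [hfh x, hhg x]

end Growth

section Potentials

variable {d N : ℕ} {p : ℝ} {lam : Fin N → ℝ}

/-- Functions splitting the cost on a set `Γ` are dominated by conjugates of continuous functions
with vanishing sum. -/
lemma exists_potentials (hp : 1 < p) (hlam : ∀ i, 0 < lam i) (i₀ : Fin N)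
    {Γ : Set (Fin N → Space d)} [Nonempty Γ] {u : Fin N → Γ → ℝ}
    (hu : ∀ m : Fin N → Γ, ∑ i, u i (m i) ≤ cost p lam fun i => (m i).1 i) :
    ∃ ψ : Fin N → Space d → ℝ, (∀ i, ψ i ∈ growthSpace p) ∧ (∀ z, ∑ i, ψ i z = 0) ∧
      ∀ i (x : Γ) z, u i x ≤ lam i * ‖x.1 i - z‖ ^ p - ψ i z := by
  classical
  obtain ⟨x₀⟩ := ‹Nonempty Γ›
  let χ : Fin N → Space d → ℝ := fun i z => ⨅ x : Γ, (lam i * ‖z - x.1 i‖ ^ p - u i x)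
  -- Fixing all other coordinates at `x₀` in the splitting inequality gives a continuous lower bound
  -- for the infimum defining `χ i`, of `p`-growth and uniform in `x`.
  let G : Fin N → Space d → ℝ := fun i z =>
    ∑ j ∈ Finset.univ.erase i, (u j x₀ - lam j * ‖z - x₀.1 j‖ ^ p)
  have hG (i : Fin N) (z : Space d) (x : Γ) : G i z ≤ lam i * ‖z - x.1 i‖ ^ p - u i x := by
    let m : Fin N → Γ := Function.update (fun _ => x₀) i x
    have h1 := (hu m).trans (cost_le hlam _ z)
    rw [← sub_nonneg, ← Finset.sum_sub_distrib,
      ← Finset.add_sum_erase _ _ (Finset.mem_univ i)] at h1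
    have h2 : ∑ j ∈ Finset.univ.erase i, (lam j * ‖(m j).1 j - z‖ ^ p - u j (m j)) = -G i z := by
      rw [← Finset.sum_neg_distrib]
      refine Finset.sum_congr rfl fun j hj => ?_
      rw [show m j = x₀ from Function.update_of_ne (Finset.ne_of_mem_erase hj) _ _, norm_sub_rev]
      ring
    rw [h2, show m i = x from Function.update_self _ _ _, norm_sub_rev] at h1
    linarith
  have hbdd (i z) : BddBelow (Set.range fun x : Γ => lam i * ‖z - x.1 i‖ ^ p - u i x) :=
    ⟨G i z, by rintro _ ⟨x, rfl⟩; exact hG i z x⟩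
  have hGcont (i) : Continuous (G i) := by
    refine continuous_finsetSum _ fun j _ => ?_
    have : Continuous fun z : Space d => ‖z - x₀.1 j‖ ^ p :=
      (continuous_id.sub continuous_const).norm.rpow_const fun _ => Or.inr (by linarith)
    fun_prop
  have hχcont (i) : Continuous (χ i) := by
    refine continuous_iff_continuousAt.2 fun z₀ => ?_
    obtain ⟨M, hM⟩ := (isCompact_closedBall z₀ 2).exists_bound_of_continuousOn (hGcont i).continuousOn
    obtain ⟨L, hL⟩ := exists_lipschitzOnWith_iInf hp (hlam i) (fun x : Γ => x.1 i) (u i)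
      (x₀ := z₀) (R := 1) (M := M) one_pos fun z hz x => by
        have h1 := hM z (Metric.ball_subset_closedBall (by simpa using hz))
        rw [Real.norm_eq_abs] at h1
        exact (abs_le.1 h1).1.trans (hG i z x)
    exact hL.continuousOn.continuousAt (Metric.ball_mem_nhds z₀ one_pos)
  have hshift (i) (w : Space d) (c : ℝ) : (fun z => lam i * ‖z - w‖ ^ p - c) ∈ growthSubmodule d p :=
    (growthSubmodule d p).sub_mem
      ((growthSubmodule d p).smul_mem (lam i) (norm_sub_rpow_mem_growthSubmodule hp w))
      (const_mem_growthSubmodule c)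
  have hχgrowth (i) : χ i ∈ growthSubmodule d p := by
    refine mem_growthSubmodule_of_le_of_le (f := G i)
      (g := fun z => lam i * ‖z - x₀.1 i‖ ^ p - u i x₀) ?_ (hshift i _ _)
      (fun z => le_ciInf (hG i z)) fun z => ciInf_le (hbdd i z) x₀
    have : G i = ∑ j ∈ Finset.univ.erase i, -(fun z => lam j * ‖z - x₀.1 j‖ ^ p - u j x₀) := by
      funext z
      simp only [G, Finset.sum_apply, Pi.neg_apply, neg_sub]
    rw [this]
    exact Submodule.sum_mem _ fun j _ => (growthSubmodule d p).neg_mem (hshift j _ _)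
  -- Near-minimizers for the different `χ i z` recombine to a single `m`, and `hu m` bounds the
  -- `u`-sum by the cost, hence by its value at the centre `z`.
  have hχsum (z) : 0 ≤ ∑ i, χ i z := by
    by_contra! hneg
    have hN : (0 : ℝ) < N := Nat.cast_pos.2 i₀.pos
    set ε : ℝ := -(∑ i, χ i z) / N with hε
    have hε0 : 0 < ε := div_pos (by linarith) hN
    have hex (i) : ∃ x : Γ, lam i * ‖z - x.1 i‖ ^ p - u i x < χ i z + ε :=
      exists_lt_of_ciInf_lt (lt_add_of_pos_right _ hε0)
    choose m hm using hex
    have h1 := Finset.sum_lt_sum_of_nonempty ⟨i₀, Finset.mem_univ i₀⟩ fun i _ => hm i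
    rw [Finset.sum_add_distrib, Finset.sum_const, Finset.card_univ, Fintype.card_fin, nsmul_eq_mul,
      hε, mul_div_cancel₀ _ hN.ne', add_neg_cancel, Finset.sum_sub_distrib] at h1
    have h2 := (hu m).trans (cost_le hlam _ z)
    simp_rw [norm_sub_rev _ z] at h2
    linarith
  -- Replacing `χ i₀` by minus the sum of the others makes the total zero. As the total was
  -- nonnegative, this only lowers `χ i₀`, which preserves the required inequality.
  let θ : Space d → ℝ := -∑ j ∈ Finset.univ.erase i₀, χ j
  have hθ (z) : θ z = -∑ j ∈ Finset.univ.erase i₀, χ j z := by simp [θ]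
  refine ⟨Function.update χ i₀ θ, fun i => ?_, fun z => ?_, fun i x z => ?_⟩
  · by_cases hi : i = i₀
    · subst hi
      rw [Function.update_self]
      refine ⟨?_, (growthSubmodule d p).neg_mem (Submodule.sum_mem _ fun j _ => hχgrowth j)⟩
      rw [show θ = fun z => -∑ j ∈ Finset.univ.erase i, χ j z from funext hθ]
      exact (continuous_finsetSum _ fun j _ => hχcont j).neg
    · rw [Function.update_of_ne hi]
      exact ⟨hχcont i, hχgrowth i⟩
  · rw [← Finset.add_sum_erase _ _ (Finset.mem_univ i₀), Function.update_self, hθ,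
      neg_add_eq_zero]
    exact Finset.sum_congr rfl fun j hj => by
      rw [Function.update_of_ne (Finset.ne_of_mem_erase hj)]
  · have h1 : Function.update χ i₀ θ i z ≤ χ i z := by
      by_cases hi : i = i₀
      · subst hi
        have := hχsum z
        rw [← Finset.add_sum_erase _ _ (Finset.mem_univ i)] at this
        rw [Function.update_self, hθ]
        linarith
      · rw [Function.update_of_ne hi]
    have h2 : χ i z ≤ lam i * ‖z - x.1 i‖ ^ p - u i x := ciInf_le (hbdd i z) x
    rw [norm_sub_rev]
    linarith

lemma ereal_coe_sum {ι : Type*} (s : Finset ι) (f : ι → ℝ) :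
    ((∑ i ∈ s, f i : ℝ) : EReal) = ∑ i ∈ s, (f i : EReal) := by
  classical
  induction s using Finset.induction_on with
  | empty => simp
  | insert i s hi ih => rw [Finset.sum_insert hi, Finset.sum_insert hi, EReal.coe_add, ih]

/-- Testing every conjugate at the same point `z` makes the `ψ i z` cancel; then the infimum over
`z` is taken. -/
lemma sum_conjugate_le_cost {ψ : Fin N → Space d → ℝ} (hψ : ∀ z, ∑ i, ψ i z = 0)
    (x : Fin N → Space d) :
    ∑ i, conjugate (lam i) p (ψ i) (x i) ≤ (cost p lam x : EReal) := by
  have h (z : Space d) : ∑ i, conjugate (lam i) p (ψ i) (x i) ≤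
      ((∑ i, lam i * ‖x i - z‖ ^ p : ℝ) : EReal) := by
    refine (Finset.sum_le_sum fun i _ => conjugate_le (ψ i) (x i) z).trans_eq ?_
    rw [← ereal_coe_sum, Finset.sum_sub_distrib, hψ z, sub_zero]
  generalize ∑ i, conjugate (lam i) p (ψ i) (x i) = A at h
  induction A using EReal.rec with
  | bot => exact bot_le
  | coe a => exact EReal.coe_le_coe_iff.2 (le_ciInf fun z => EReal.coe_le_coe_iff.1 (h z))
  | top => exact absurd (h 0) (by simp)

/-- Weak duality. -/
lemma dualValue_le (hp : 1 < p) (hlam : ∀ i, 0 < lam i) {μ : Fin N → Measure (Space d)}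
    (hmom : ∀ i, Integrable (fun x => ‖x‖ ^ p) (μ i)) {γ : Measure (Fin N → Space d)}
    (hγ : γ ∈ plans μ) {φ : Fin N → Space d → EReal} (hφ : φ ∈ dualClass p lam μ) :
    dualValue μ φ ≤ ∫ x, cost p lam x ∂γ := by
  obtain ⟨hL1, -, hle⟩ := hφ
  have hint (i) := integrable_comp_eval hγ i (hL1 i).2
  have heq : dualValue μ φ = ∫ x, ∑ i, (φ i (x i)).toReal ∂γ := by
    rw [integral_finsetSum _ fun i _ => hint i]
    exact Finset.sum_congr rfl fun i _ =>
      (integral_comp_eval hγ i (hL1 i).2.aestronglyMeasurable).symm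
  rw [heq]
  refine integral_mono_ae (integrable_finsetSum _ fun i _ => hint i)
    (integrable_cost hp hlam hmom hγ) ?_
  -- `toReal` sends `⊥` to `0`, so the pointwise bound passes to real parts only where all terms are
  -- finite.
  have hfin : ∀ᵐ x ∂γ, ∀ i, φ i (x i) ≠ ⊥ ∧ φ i (x i) ≠ ⊤ := by
    refine ae_all_iff.2 fun i => ?_
    have h := (hL1 i).1
    rw [← hγ.2 i] at h
    exact ae_of_ae_map (measurable_pi_apply i).aemeasurable h
  filter_upwards [hfin] with x hx
  have h := hle x
  rw [← EReal.coe_le_coe_iff, ereal_coe_sum]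
  refine le_trans (le_of_eq (Finset.sum_congr rfl fun i _ => ?_)) h
  exact EReal.coe_toReal (hx i).2 (hx i).1

/-- Conjugates of potentials which touch the cost on a set of full measure for a plan are
competitors of the dual problem with dual value the cost of the plan. -/
lemma conjugate_mem_dualClass (hp : 1 < p) (hlam : ∀ i, 0 < lam i) {μ : Fin N → Measure (Space d)}
    (hmom : ∀ i, Integrable (fun x => ‖x‖ ^ p) (μ i)) (hprob : ∀ i, IsProbabilityMeasure (μ i))
    {γ : Measure (Fin N → Space d)}
    (hγ : γ ∈ plans μ) {Γ : Set (Fin N → Space d)} (hΓ : Γ ∈ ae γ) {u : Fin N → Γ → ℝ}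
    (hu : ∀ x : Γ, ∑ i, u i x = cost p lam x.1) {ψ : Fin N → Space d → ℝ}
    (hψ : ∀ z, ∑ i, ψ i z = 0) (huψ : ∀ i (x : Γ) z, u i x ≤ lam i * ‖x.1 i - z‖ ^ p - ψ i z) :
    (fun i => conjugate (lam i) p (ψ i)) ∈ dualClass p lam μ ∧
      dualValue μ (fun i => conjugate (lam i) p (ψ i)) = ∫ x, cost p lam x ∂γ := by
  set φ : Fin N → Space d → EReal := fun i => conjugate (lam i) p (ψ i) with hφ
  have hmeas (i) : Measurable (φ i) := measurable_conjugate hp (ψ i)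
  have htop (i x) : φ i x ≠ ⊤ := conjugate_ne_top (ψ i) x
  have hu_le (x : Γ) (i) : (u i x : EReal) ≤ φ i (x.1 i) :=
    le_iInf fun z => EReal.coe_le_coe_iff.2 (huψ i x z)
  have hbot (x : Γ) (i) : φ i (x.1 i) ≠ ⊥ := fun h => by
    have := hu_le x i
    simp [h] at this
  have hcoe (x : Γ) (i) : ((φ i (x.1 i)).toReal : EReal) = φ i (x.1 i) :=
    EReal.coe_toReal (htop i _) (hbot x i)
  have hle (x) : ∑ i, φ i (x i) ≤ (cost p lam x : EReal) := sum_conjugate_le_cost hψ x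
  -- A squeeze: `u i ≤ φ i` termwise, while the `φ i` sum to at most the cost, which is the sum of
  -- the `u i`.
  have hsum (x : Γ) : ∑ i, (φ i (x.1 i)).toReal = cost p lam x.1 := by
    refine le_antisymm ?_ ?_
    · rw [← EReal.coe_le_coe_iff, ereal_coe_sum]
      exact (le_of_eq (Finset.sum_congr rfl fun i _ => hcoe x i)).trans (hle x)
    · rw [← hu x]
      refine Finset.sum_le_sum fun i _ => ?_
      rw [← EReal.coe_le_coe_iff, hcoe]
      exact hu_le x i
  let B : Fin N → Space d → ℝ := fun i y => lam i * ‖y‖ ^ p - ψ i 0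
  have hB (x : Γ) (i) : (φ i (x.1 i)).toReal ≤ B i (x.1 i) := by
    rw [← EReal.coe_le_coe_iff, hcoe]
    have := conjugate_le (l := lam i) (p := p) (ψ i) (x.1 i) 0
    rwa [sub_zero] at this
  have hBint (i) : Integrable (B i) (μ i) := by
    have := hprob i
    exact ((hmom i).const_mul _).sub (integrable_const _)
  -- Lower bounds for `φ i` come from the upper bounds for the other terms, because the whole sum is
  -- a nonnegative cost.
  have habs (x : Γ) (i) : |(φ i (x.1 i)).toReal| ≤ ∑ j, |B j (x.1 j)| := by
    have h1 := hsum x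
    rw [← Finset.add_sum_erase _ _ (Finset.mem_univ i)] at h1 ⊢
    have h2 : ∑ j ∈ Finset.univ.erase i, (φ j (x.1 j)).toReal ≤
        ∑ j ∈ Finset.univ.erase i, |B j (x.1 j)| :=
      Finset.sum_le_sum fun j _ => (hB x j).trans (le_abs_self _)
    have h3 : 0 ≤ ∑ j ∈ Finset.univ.erase i, |B j (x.1 j)| :=
      Finset.sum_nonneg fun j _ => abs_nonneg _
    have h4 := (hB x i).trans (le_abs_self _)
    have h5 := cost_nonneg (p := p) hlam x.1
    have h6 := abs_nonneg (B i (x.1 i))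
    rw [abs_le]
    constructor <;> linarith
  have hint (i) : Integrable (fun x => (φ i (x i)).toReal) γ := by
    refine Integrable.mono' (g := fun x => ∑ j, |B j (x j)|)
      (integrable_finsetSum _ fun j _ => (integrable_comp_eval hγ j (hBint j)).abs)
      ((hmeas i).comp (measurable_pi_apply i)).ereal_toReal.aestronglyMeasurable ?_
    filter_upwards [hΓ] with x hx
    exact habs ⟨x, hx⟩ i
  have hmem : φ ∈ dualClass p lam μ := by
    refine ⟨fun i => ⟨?_, ?_⟩, htop, hle⟩
    · have hset : MeasurableSet {y | φ i y ≠ ⊥ ∧ φ i y ≠ ⊤} :=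
        ((hmeas i) (measurableSet_singleton ⊥)).compl.inter
          ((hmeas i) (measurableSet_singleton ⊤)).compl
      rw [← hγ.2 i]
      refine (ae_map_iff (measurable_pi_apply i).aemeasurable hset).2 ?_
      filter_upwards [hΓ] with x hx
      exact ⟨hbot ⟨x, hx⟩ i, htop i _⟩
    · rw [← hγ.2 i]
      exact (integrable_map_measure (hmeas i).ereal_toReal.aestronglyMeasurable
        (measurable_pi_apply i).aemeasurable).2 (hint i)
  refine ⟨hmem, ?_⟩
  calc dualValue μ φ = ∑ i, ∫ x, (φ i (x i)).toReal ∂γ := Finset.sum_congr rfl fun i _ =>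
        (integral_comp_eval hγ i (hmem.1 i).2.aestronglyMeasurable).symm
    _ = ∫ x, ∑ i, (φ i (x i)).toReal ∂γ := (integral_finsetSum _ fun i _ => hint i).symm
    _ = ∫ x, cost p lam x ∂γ := by
        refine integral_congr_ae ?_
        filter_upwards [hΓ] with x hx
        exact hsum ⟨x, hx⟩

end Potentials

end MMOT


theorem theorem4p1 (d N : ℕ) (p : ℝ) (hp : 1 < p)
    (lam : Fin N → ℝ) (hlam : ∀ i, 0 < lam i) (hsum : ∑ i, lam i = 1)
    (μ : Fin N → Measure (MMOT.Space d)) (hprob : ∀ i, IsProbabilityMeasure (μ i))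
    (hmom : ∀ i, Integrable (fun x => ‖x‖ ^ p) (μ i)) :
    -- the primal problem has a minimizer and a finite value
    (∃ γ ∈ MMOT.plans μ, MMOT.transportCost p lam γ = MMOT.primalValue p lam μ) ∧
    MMOT.primalValue p lam μ ≠ ∞ ∧
    -- Kantorovich duality
    IsLUB (MMOT.dualValue μ '' MMOT.dualClass p lam μ) (MMOT.primalValue p lam μ).toReal ∧
    -- a maximizer of the special form, and its differentiability
    ∃ φ ∈ MMOT.conjugateClass p lam μ,
      IsMaxOn (MMOT.dualValue μ) (MMOT.dualClass p lam μ) φ ∧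
      ∀ i, ∀ᵐ x : MMOT.Space d, x ∈ convexHull ℝ (μ i).support →
        MMOT.EDifferentiableAt (φ i) x := by
  -- With no index the weights would sum to `0`.
  obtain ⟨i₀⟩ : Nonempty (Fin N) := by
    by_contra h
    rw [not_nonempty_iff] at h
    simp at hsum
  obtain ⟨γ, hγ, hopt⟩ := MMOT.exists_optimal_plan hp hlam hprob
  have hγp : IsProbabilityMeasure γ := hγ.1
  have hvalue : MMOT.primalValue p lam μ = ENNReal.ofReal (∫ x, MMOT.cost p lam x ∂γ) := by
    rw [← hopt, MMOT.transportCost_eq hp hlam hmom hγ]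
  have hvalue' : (MMOT.primalValue p lam μ).toReal = ∫ x, MMOT.cost p lam x ∂γ := by
    rw [hvalue, ENNReal.toReal_ofReal (integral_nonneg (MMOT.cost_nonneg hlam))]
  have : Nonempty γ.support :=
    (Measure.nonempty_support (IsProbabilityMeasure.ne_zero γ)).to_subtype
  -- The splitting is indexed by whole points of the support, with the cost using only the `i`-th
  -- coordinate of the `i`-th point; `u i` need not factor through that coordinate.
  obtain ⟨u, hu, hu'⟩ := MMOT.exists_splitting (X := γ.support) i₀.pos.ne'
    (fun m => MMOT.cost p lam fun i => (m i).1 i)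
    fun F a b ha hb hab => MMOT.sum_cost_le_of_mem_support hp hlam i₀ hprob hmom hγ hopt
      (fun k : F => k.1.1) (fun k => k.1.2) ha hb hab
  obtain ⟨ψ, hψ, hψ0, huψ⟩ := MMOT.exists_potentials hp hlam i₀ hu
  obtain ⟨hmem, hdual⟩ := MMOT.conjugate_mem_dualClass hp hlam hmom hprob hγ
    Measure.support_mem_ae hu' hψ0 huψ
  refine ⟨⟨γ, hγ, hopt⟩, by rw [hvalue]; exact ENNReal.ofReal_ne_top, ?_,
    _, ⟨hmem, ψ, hψ, hψ0, fun _ => rfl⟩, ?_, fun i => ?_⟩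
  · rw [hvalue']
    refine IsGreatest.isLUB ⟨⟨_, hmem, hdual⟩, ?_⟩
    rintro _ ⟨φ, hφ, rfl⟩
    exact MMOT.dualValue_le hp hlam hmom hγ hφ
  · intro φ hφ
    exact (MMOT.dualValue_le hp hlam hmom hγ hφ).trans_eq hdual.symm
  · exact MMOT.ae_eDifferentiableAt_conjugate hp (hlam i) (hψ i)
      ((hmem.1 i).1.mono fun x hx => hx.1)
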